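/- **Algebras.** A partial function on a set $X$ is a subset $f\subseteq X\times X$ such that $(x,y),(x,z)\in f$ implies $y=z$. On partial functions on $X$ consider composition $f\mathbin{;}g$ (first $f$, then $g$), antidomain $\mathsf A(f)=\{(x,x): \nexists y\,(x,y)\in f\}$, range $\mathsf R(f)=\{(y,y):\exists x\,(x,y)\in f\}$, and preferential union $f\sqcup g$ (equal to $f$ where $f$ is defined, and to $g$ elsewhere). A *representable* algebra is a nonempty algebra $(A,;,\mathsf A,\mathsf R,\sqcup)$ isomorphic to a set of partial functions on some set, closed under these operations. Write $\mathsf D(a)=\mathsf A(\mathsf A(a))$ and $a\le b$ for $\mathsf D(a)\mathbin{;}b=a$; the elements $\mathsf A(a)$ form a Boolean algebra $\mathsf D[A]$ with meet $;$ and complement $\mathsf A$. A *filter* of $A$ is a nonempty, upward-closed, downward-directed subset; it is *prime* if it is proper and $a\sqcup b\in F$ implies $a\in F$ or $b\in F$. A homomorphism (preserving all four operations) is *locally proper* if the inverse image of every prime filter is a prime filter. **Categories.** A *topological category* is a small category whose sets of objects and of arrows are topological spaces such that source, target, composition and identity-assignment are continuous. It is *Stone étale* if the source map is a local homeomorphism,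 the target map is open, and the space of objects is compact and totally separated. A *multivalued functor* $F\colon C\to D$ of topological categories is a continuous function $F$ on objects together with a relation $F$ from arrows of $C$ to arrows of $D$, under which inverse images of open sets are open, such that: $g\in F(f)$ for $f\colon x\to y$ implies $g\colon F(x)\to F(y)$; $1_{F(x)}\in F(1_x)$; and $g_1\in F(f_1)$, $g_2\in F(f_2)$ imply $g_1\cdot g_2\in F(f_1\cdot f_2)$ whenever $f_1\cdot f_2$ is defined. It is *star coherent* if * whenever $f_1,f_2$ have the same source and $F(f_1)\cap F(f_2)\ne\emptyset$, then $f_1=f_2$; * for every object $x$ of $C$, every arrow of $D$ with source $F(x)$ lies in $F(f)$ for some $f$ with source $x$; * for every object $y$ of $C$ and every open set $U$ of arrows of $D$ containing an arrow with target $F(y)$, some element of $U$ lies in $F(f)$ for some $f$ with target $y$. A *star-coherent functor* is a star-coherent multivalued functor for which $F(f)$ is a singleton for every arrow $f$. Let $\mathscr A$ be the category of representable algebras and homomorphisms, and $\mathscr A'$ its subcategory with the same objects and only the locally proper homomorphisms. Let $\mathscr C$ be the category of Stone étale categories all of whose arrows are epimorphisms, with star-coherent multivalued functors, and $\mathscr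 C'$ its subcategory with the same objects and only the star-coherent functors. **Theorem.** There is an equivalence $E\colon\mathscr A^{\mathrm{op}}\simeq\mathscr C$ that restricts to an equivalence $E'\colon\mathscr A'^{\mathrm{op}}\simeq\mathscr C'$: the functors of $E'$ in both directions are the restrictions of those of $E$. Moreover $E$ can be taken to be the prime filter duality, as follows, up to identification of objects and arrows. The category $E(A)$ has as objects the ultrafilters of $\mathsf D[A]$ (with the topology generated by the sets $\{\mu:\alpha\in\mu\}$, $\alpha\in \mathsf D[A]$) and as arrows the prime filters of $A$ (with the topology generated by the sets $\{P: a\in P\}$, $a\in A$). The source of $P$ is $\mathsf D[P]$, its target is the upward closure of $\mathsf R[P]$ in $\mathsf D[A]$, the identity at $\mu$ is the upward closure of $\mu$ in $A$, and the composite of $P$ and $Q$ (first $P$) is the upward closure of $\{a\mathbin{;}b: a\in P,\ b\in Q\}$. For a homomorphism $h\colon A\to B$, the multivalued functor $E(h)\colon E(B)\to E(A)$ is $\mu\mapsto h^{-1}(\mu)\cap \mathsf D[A]$ on objects and relates $P$ to exactly the prime filters $Q$ of $A$ with $Q\subseteq h^{-1}(P)$. -/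

import Mathlib

open CategoryTheory

universe u

/-! ## Algebras of partial functions -/

namespace PartialFun

variable {X : Type u}

/-- A partial function on `X`, as a subset of `X × X`. -/
def IsPartialFunction (f : Set (X × X)) : Prop :=
  ∀ x y z, (x, y) ∈ f → (x, z) ∈ f → y = z

/-- Composition, with the first factor applied first. -/
def comp (f g : Set (X × X)) : Set (X × X) :=
  {p | ∃ y, (p.1, y) ∈ f ∧ (y, p.2) ∈ g}

/-- The diagonal of the antidomain. -/
def antidomain (f : Set (X × X)) : Set (X × X) :=
  {p | p.1 = p.2 ∧ ¬ ∃ y, (p.1, y) ∈ f}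

/-- The diagonal of the range. -/
def range (f : Set (X × X)) : Set (X × X) :=
  {p | p.1 = p.2 ∧ ∃ x, (x, p.1) ∈ f}

/-- Preferential union: `f` where `f` is defined, and `g` elsewhere. -/
def prefUnion (f g : Set (X × X)) : Set (X × X) :=
  {p | p ∈ f ∨ ((¬ ∃ y, (p.1, y) ∈ f) ∧ p ∈ g)}

end PartialFun

/-- A (nonempty) algebra with operations composition, antidomain, range and preferential union
that is isomorphic to an algebra of partial functions on some set. -/
structure FunctionAlgebra : Type (u + 1) where
  carrier : Type u
  nonempty : Nonempty carrier
  comp : carrier → carrier → carrier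
  anti : carrier → carrier
  ran : carrier → carrier
  pref : carrier → carrier → carrier
  representable : ∃ (X : Type u) (ρ : carrier → Set (X × X)),
    Function.Injective ρ ∧
    (∀ a, PartialFun.IsPartialFunction (ρ a)) ∧
    (∀ a b, ρ (comp a b) = PartialFun.comp (ρ a) (ρ b)) ∧
    (∀ a, ρ (anti a) = PartialFun.antidomain (ρ a)) ∧
    (∀ a, ρ (ran a) = PartialFun.range (ρ a)) ∧
    (∀ a b, ρ (pref a b) = PartialFun.prefUnion (ρ a) (ρ b))

namespace FunctionAlgebra

/-- Homomorphisms of algebras in the signature (composition, antidomain, range, preferential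
union). -/
@[ext]
structure Hom (A B : FunctionAlgebra.{u}) : Type u where
  toFun : A.carrier → B.carrier
  map_comp : ∀ a b, toFun (A.comp a b) = B.comp (toFun a) (toFun b)
  map_anti : ∀ a, toFun (A.anti a) = B.anti (toFun a)
  map_ran : ∀ a, toFun (A.ran a) = B.ran (toFun a)
  map_pref : ∀ a b, toFun (A.pref a b) = B.pref (toFun a) (toFun b)

instance : Category.{u} FunctionAlgebra.{u} where
  Hom A B := Hom A B
  id A := ⟨fun a => a, fun _ _ => rfl, fun _ => rfl, fun _ => rfl, fun _ _ => rfl⟩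
  comp {_ _ _} h k :=
    { toFun := fun a => k.toFun (h.toFun a)
      map_comp := fun a b => by rw [h.map_comp, k.map_comp]
      map_anti := fun a => by rw [h.map_anti, k.map_anti]
      map_ran := fun a => by rw [h.map_ran, k.map_ran]
      map_pref := fun a b => by rw [h.map_pref, k.map_pref] }

variable (A : FunctionAlgebra.{u})

/-- The domain operation. -/
def dom (a : A.carrier) : A.carrier := A.anti (A.anti a)

/-- The order: under any representation it is inclusion of partial functions. -/
def le (a b : A.carrier) : Prop := A.comp (A.dom a) b = a

/-- The set of domain elements, a Boolean algebra with meet `comp` and complement `anti`. -/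
def domElts : Set A.carrier := Set.range A.anti

/-- Nonempty, upward-closed, downward-directed subsets. -/
structure IsFilter (F : Set A.carrier) : Prop where
  nonempty : F.Nonempty
  upward : ∀ a b, a ∈ F → A.le a b → b ∈ F
  directed : ∀ a b, a ∈ F → b ∈ F → ∃ c ∈ F, A.le c a ∧ A.le c b

/-- Prime filters: proper filters that contain `a` or `b` whenever they contain the preferential
union of `a` and `b`. -/
structure IsPrimeFilter (F : Set A.carrier) : Prop extends A.IsFilter F where
  proper : F ≠ Set.univ
  prime : ∀ a b, A.pref a b ∈ F → a ∈ F ∨ b ∈ F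

/-- Ultrafilters of the Boolean algebra of domain elements. -/
structure IsDomUltrafilter (μ : Set A.carrier) : Prop where
  subset : μ ⊆ A.domElts
  nonempty : μ.Nonempty
  upward : ∀ α β, α ∈ μ → β ∈ A.domElts → A.le α β → β ∈ μ
  meet : ∀ α β, α ∈ μ → β ∈ μ → A.comp α β ∈ μ
  ultra : ∀ α ∈ A.domElts, (A.anti α ∈ μ ↔ α ∉ μ)

/-- The set of prime filters. -/
def PrimeFilters : Type u := {P : Set A.carrier // A.IsPrimeFilter P}

/-- The set of ultrafilters of domain elements. -/
def DomUltrafilters : Type u := {μ : Set A.carrier // A.IsDomUltrafilter μ}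

/-- The topology generated by the sets of prime filters containing a given element. -/
instance : TopologicalSpace A.PrimeFilters :=
  TopologicalSpace.generateFrom (Set.range fun a => {P : A.PrimeFilters | a ∈ P.1})

/-- The topology generated by the sets of ultrafilters containing a given domain element. -/
instance : TopologicalSpace A.DomUltrafilters :=
  TopologicalSpace.generateFrom ((fun α => {μ : A.DomUltrafilters | α ∈ μ.1}) '' A.domElts)

/-- A homomorphism is locally proper if the inverse image of every prime filter is a prime
filter. -/
def locallyProper : MorphismProperty FunctionAlgebra.{u} := fun A B h =>
  ∀ P : Set B.carrier, B.IsPrimeFilter P → A.IsPrimeFilter (Hom.toFun h ⁻¹' P)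

instance : locallyProper.{u}.IsMultiplicative where
  id_mem _ _ hP := hP
  comp_mem _ _ hf hg P hP := hf _ (hg P hP)

end FunctionAlgebra

/-! ## Stone étale categories -/

/-- A small category internal to topological spaces. The composite `comp f g _` is `f` followed
by `g`. -/
structure TopologicalCategory : Type (u + 1) where
  Obj : Type u
  Arr : Type u
  [topObj : TopologicalSpace Obj]
  [topArr : TopologicalSpace Arr]
  src : Arr → Obj
  tgt : Arr → Obj
  one : Obj → Arr
  comp : ∀ f g : Arr, tgt f = src g → Arr
  src_one : ∀ x, src (one x) = x
  tgt_one : ∀ x, tgt (one x) = x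
  src_comp : ∀ f g h, src (comp f g h) = src f
  tgt_comp : ∀ f g h, tgt (comp f g h) = tgt g
  one_comp : ∀ f, comp (one (src f)) f (tgt_one _) = f
  comp_one : ∀ f, comp f (one (tgt f)) (src_one _).symm = f
  assoc : ∀ f g k (h₁ : tgt f = src g) (h₂ : tgt g = src k),
    comp (comp f g h₁) k ((tgt_comp f g h₁).trans h₂) =
      comp f (comp g k h₂) (h₁.trans (src_comp g k h₂).symm)
  continuous_src : Continuous src
  continuous_tgt : Continuous tgt
  continuous_one : Continuous one
  continuous_comp :
    Continuous fun p : {p : Arr × Arr // tgt p.1 = src p.2} => comp p.1.1 p.1.2 p.2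

attribute [instance] TopologicalCategory.topObj TopologicalCategory.topArr

/-- A Stone étale category all of whose arrows are epimorphisms. -/
structure StoneEtaleCategory : Type (u + 1) extends TopologicalCategory.{u} where
  isLocalHomeomorph_src : IsLocalHomeomorph src
  isOpenMap_tgt : IsOpenMap tgt
  compact_obj : CompactSpace Obj
  totallySeparated_obj : TotallySeparatedSpace Obj
  epi : ∀ (f g k : Arr) (h₁ : tgt f = src g) (h₂ : tgt f = src k),
    comp f g h₁ = comp f k h₂ → g = k

namespace TopologicalCategory

/-- A multivalued functor of topological categories: a continuous function on objects and a
continuous relation on arrows. -/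
@[ext]
structure MultivaluedFunctor (C D : TopologicalCategory.{u}) : Type u where
  obj : C.Obj → D.Obj
  rel : C.Arr → D.Arr → Prop
  src_rel : ∀ f g, rel f g → D.src g = obj (C.src f)
  tgt_rel : ∀ f g, rel f g → D.tgt g = obj (C.tgt f)
  one_rel : ∀ x, rel (C.one x) (D.one (obj x))
  comp_rel : ∀ f₁ f₂ g₁ g₂ (hf : C.tgt f₁ = C.src f₂) (hg : D.tgt g₁ = D.src g₂),
    rel f₁ g₁ → rel f₂ g₂ → rel (C.comp f₁ f₂ hf) (D.comp g₁ g₂ hg)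
  continuous_obj : Continuous obj
  continuous_rel : ∀ U : Set D.Arr, IsOpen U → IsOpen {f | ∃ g ∈ U, rel f g}

namespace MultivaluedFunctor

variable {C D E : TopologicalCategory.{u}}

/-- The identity functor. -/
def id (C : TopologicalCategory.{u}) : MultivaluedFunctor C C where
  obj x := x
  rel f g := f = g
  src_rel := by rintro f _ rfl; rfl
  tgt_rel := by rintro f _ rfl; rfl
  one_rel _ := rfl
  comp_rel := by rintro f₁ f₂ _ _ hf hg rfl rfl; rfl
  continuous_obj := continuous_id
  continuous_rel U hU := by simpa using hU

/-- Composition: of functions on objects, and of relations on arrows. -/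
def comp (F : MultivaluedFunctor C D) (G : MultivaluedFunctor D E) : MultivaluedFunctor C E where
  obj x := G.obj (F.obj x)
  rel f k := ∃ g, F.rel f g ∧ G.rel g k
  src_rel := by
    rintro f k ⟨g, hF, hG⟩
    rw [G.src_rel _ _ hG, F.src_rel _ _ hF]
  tgt_rel := by
    rintro f k ⟨g, hF, hG⟩
    rw [G.tgt_rel _ _ hG, F.tgt_rel _ _ hF]
  one_rel x := ⟨_, F.one_rel x, G.one_rel _⟩
  comp_rel := by
    rintro f₁ f₂ k₁ k₂ hf hk ⟨g₁, hF₁, hG₁⟩ ⟨g₂, hF₂, hG₂⟩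
    have hg : D.tgt g₁ = D.src g₂ := by
      rw [F.tgt_rel _ _ hF₁, F.src_rel _ _ hF₂, hf]
    exact ⟨_, F.comp_rel _ _ _ _ hf hg hF₁ hF₂, G.comp_rel _ _ _ _ hg hk hG₁ hG₂⟩
  continuous_obj := G.continuous_obj.comp F.continuous_obj
  continuous_rel U hU := by
    convert F.continuous_rel _ (G.continuous_rel U hU) using 1
    ext f
    constructor
    · rintro ⟨k, hk, g, hF, hG⟩
      exact ⟨g, ⟨k, hk, hG⟩, hF⟩
    · rintro ⟨g, ⟨k, hk, hG⟩, hF⟩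
      exact ⟨k, hk, g, hF, hG⟩

/-- Star injective, star surjective and co-pseudo star surjective. -/
structure IsStarCoherent (F : MultivaluedFunctor C D) : Prop where
  star_injective : ∀ f₁ f₂ g, C.src f₁ = C.src f₂ → F.rel f₁ g → F.rel f₂ g → f₁ = f₂
  star_surjective : ∀ x g, D.src g = F.obj x → ∃ f, C.src f = x ∧ F.rel f g
  coPseudoStar_surjective : ∀ (y : C.Obj) (U : Set D.Arr), IsOpen U →
    (∃ g ∈ U, D.tgt g = F.obj y) → ∃ g ∈ U, ∃ f, C.tgt f = y ∧ F.rel f g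

theorem IsStarCoherent.id (C : TopologicalCategory.{u}) :
    (MultivaluedFunctor.id C).IsStarCoherent where
  star_injective f₁ f₂ g _ h₁ h₂ := Eq.trans h₁ (Eq.symm h₂)
  star_surjective x g h := ⟨g, h, rfl⟩
  coPseudoStar_surjective := by
    rintro y U _ ⟨g, hg, h⟩
    exact ⟨g, hg, g, h, rfl⟩

theorem IsStarCoherent.comp {F : MultivaluedFunctor C D} {G : MultivaluedFunctor D E}
    (hF : F.IsStarCoherent) (hG : G.IsStarCoherent) : (F.comp G).IsStarCoherent where
  star_injective := by
    rintro f₁ f₂ k h ⟨g₁, hF₁, hG₁⟩ ⟨g₂, hF₂, hG₂⟩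
    have hg : g₁ = g₂ := hG.star_injective g₁ g₂ k
      (by rw [F.src_rel _ _ hF₁, F.src_rel _ _ hF₂, h]) hG₁ hG₂
    subst hg
    exact hF.star_injective _ _ _ h hF₁ hF₂
  star_surjective x k hk := by
    obtain ⟨g, hg, hG'⟩ := hG.star_surjective (F.obj x) k hk
    obtain ⟨f, hf, hF'⟩ := hF.star_surjective x g hg
    exact ⟨f, hf, g, hF', hG'⟩
  coPseudoStar_surjective y U hU hne := by
    obtain ⟨k, hk, g, hg, hG'⟩ := hG.coPseudoStar_surjective (F.obj y) U hU hne
    obtain ⟨g', ⟨k', hk', hG''⟩, f, hf, hF'⟩ :=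
      hF.coPseudoStar_surjective y _ (G.continuous_rel U hU) ⟨g, ⟨k, hk, hG'⟩, hg⟩
    exact ⟨k', hk', f, hf, g', hF', hG''⟩

end MultivaluedFunctor

end TopologicalCategory

namespace StoneEtaleCategory

open TopologicalCategory

/-- Star-coherent multivalued functors. -/
@[ext]
structure Hom (C D : StoneEtaleCategory.{u}) : Type u extends
    MultivaluedFunctor C.toTopologicalCategory D.toTopologicalCategory where
  starCoherent : toMultivaluedFunctor.IsStarCoherent

instance : Category.{u} StoneEtaleCategory.{u} where
  Hom C D := Hom C D
  id C := ⟨MultivaluedFunctor.id _, MultivaluedFunctor.IsStarCoherent.id _⟩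
  comp F G := ⟨F.toMultivaluedFunctor.comp G.toMultivaluedFunctor,
    F.starCoherent.comp G.starCoherent⟩
  id_comp F := by
    apply Hom.ext
    · rfl
    · funext f g
      simp [MultivaluedFunctor.comp, MultivaluedFunctor.id]
  comp_id F := by
    apply Hom.ext
    · rfl
    · funext f g
      simp [MultivaluedFunctor.comp, MultivaluedFunctor.id]
  assoc F G K := by
    apply Hom.ext
    · rfl
    · funext f g
      apply propext
      constructor
      · rintro ⟨b, ⟨a, h₁, h₂⟩, h₃⟩
        exact ⟨a, h₁, b, h₂, h₃⟩
      · rintro ⟨a, h₁, b, h₂, h₃⟩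
        exact ⟨b, ⟨a, h₁, h₂⟩, h₃⟩

/-- The star-coherent multivalued functors that are functors, that is, whose relation on arrows is
(the graph of) a function. The clauses in the definition of a multivalued functor are then exactly
preservation of sources, targets, identities and composition, and continuity of both functions. -/
def singleValued : MorphismProperty StoneEtaleCategory.{u} := fun _ _ F =>
  ∀ f, ∃! g, (Hom.toMultivaluedFunctor F).rel f g

instance : singleValued.{u}.IsMultiplicative where
  id_mem _ f := ⟨f, rfl, fun _ h => Eq.symm h⟩
  comp_mem F G hF hG f := by
    obtain ⟨g, hg, hg'⟩ := hF f
    obtain ⟨k, hk, hk'⟩ := hG g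
    refine ⟨k, ⟨g, hg, hk⟩, ?_⟩
    rintro k' ⟨g', h₁, h₂⟩
    have := hg' g' h₁
    subst this
    exact hk' k' h₂

end StoneEtaleCategory

/-! ## The prime filter functor -/

/-- An identification of the topological category `C` with the category of prime filters of `A`:
objects are the ultrafilters of domain elements, arrows are the prime filters, the source of `P` is
`D[P]`, the target is the upward closure (in the domain elements) of `R[P]`, the identity at `μ`
is the upward closure of `μ`, and the composite of `P` and `Q` is the upward closure of the set of
products of an element of `P` with an element of `Q`. -/
structure PrimeFilterModel (A : FunctionAlgebra.{u}) (C : TopologicalCategory.{u}) : Type u where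
  objEquiv : C.Obj ≃ₜ A.DomUltrafilters
  arrEquiv : C.Arr ≃ₜ A.PrimeFilters
  src_eq : ∀ f, (objEquiv (C.src f)).1 = A.dom '' (arrEquiv f).1
  tgt_eq : ∀ f, (objEquiv (C.tgt f)).1 =
    {α | α ∈ A.domElts ∧ ∃ a ∈ (arrEquiv f).1, A.le (A.ran a) α}
  one_eq : ∀ x, (arrEquiv (C.one x)).1 = {a | ∃ α ∈ (objEquiv x).1, A.le α a}
  comp_eq : ∀ f g h, (arrEquiv (C.comp f g h)).1 =
    {c | ∃ a ∈ (arrEquiv f).1, ∃ b ∈ (arrEquiv g).1, A.le (A.comp a b) c}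

/-- `F` is (up to identification of objects and arrows) the functor sending an algebra to its
category of prime filters, and a homomorphism `h` to the multivalued functor given on objects by
inverse image under `h` and relating a prime filter `P` to the prime filters `Q ⊆ h⁻¹(P)`. -/
def IsPrimeFilterFunctor (F : FunctionAlgebra.{u}ᵒᵖ ⥤ StoneEtaleCategory.{u}) : Prop :=
  ∃ e : ∀ A : FunctionAlgebra.{u},
      PrimeFilterModel A (F.obj (Opposite.op A)).toTopologicalCategory,
    ∀ (A B : FunctionAlgebra.{u}) (h : A ⟶ B),
      (∀ x, ((e A).objEquiv
          ((StoneEtaleCategory.Hom.toMultivaluedFunctor (F.map h.op)).obj x)).1 =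
        {α | α ∈ A.domElts ∧ FunctionAlgebra.Hom.toFun h α ∈ ((e B).objEquiv x).1}) ∧
      (∀ f g, (StoneEtaleCategory.Hom.toMultivaluedFunctor (F.map h.op)).rel f g ↔
        ((e A).arrEquiv g).1 ⊆ FunctionAlgebra.Hom.toFun h ⁻¹' ((e B).arrEquiv f).1)

/-- The category of representable algebras and locally proper homomorphisms. -/
abbrev LocallyProperAlgebras : Type (u + 1) :=
  WideSubcategory FunctionAlgebra.locallyProper.{u}

/-- The category of Stone étale categories all of whose arrows are epimorphisms, and star-coherent
functors. -/
abbrev SingleValuedCategories : Type (u + 1) :=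
  WideSubcategory StoneEtaleCategory.singleValued.{u}

/-! Prime filters are germs. If `μ` is an ultrafilter of domain elements and `D(a) ∈ μ`, the
elements above some `α ; a` with `α ∈ μ` form a prime filter with source `μ`; conversely every prime
filter is the germ, at its source, of any of its members (`IsPrimeFilter.eq_germ`). Hence a prime
filter is determined by its source and a single member. So the source map is injective on the basic
open set of `a`, with image the clopen set given by `D(a)`; composites are germs of products, and
arrows are epimorphisms. The target map sends the basic open set of `a` onto the clopen set given by
`R(a)` (`exists_tgtSet_eq`). Objects form a compact space because it is a continuous image of the
ultrafilters on the base of a representation.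

In the other direction, a Stone étale category yields the algebra of its sections: open sets of
arrows on which the source map is injective with closed image. To represent it, let an arrow `f : x
⟶ y` carry a set `S` of arrows out of `x` to `{g | f ; g ∈ S}`. Composition becomes composition of
partial functions and the action is faithful; ranges come out right because epimorphisms make every
set of arrows out of `y` a value of `f`.

A star-coherent multivalued functor acts on sections by inverse image. Star injectivity and
surjectivity give preservation of composition, antidomain and preferential union, and the third
clause gives preservation of range. Conversely, the inverse image of a prime filter under a
homomorphism is the union of the prime filters inside it (`Hom.exists_subset_of_mem`), which
supplies the relation on arrows.

The two constructions are inverse up to natural isomorphism: `a` goes to its basic open set, onto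
all sections by compactness and gluing with preferential union; an arrow goes to the prime filter of
sections containing it. Since distinct prime filters are incomparable, local properness amounts to
the relation being single-valued, so the equivalence restricts. -/

namespace FunctionAlgebra

/-! ### Pointwise calculus in a chosen representation. -/

section Representation

variable (A : FunctionAlgebra.{u})

/-- The base set of a chosen representation. -/
def Pt : Type u := A.representable.choose

variable {A}

/-- The partial function representing an element, as a relation. -/
def r (a : A.carrier) (x y : A.Pt) : Prop :=
  (x, y) ∈ A.representable.choose_spec.choose a

theorem r_ext {a b : A.carrier} (h : ∀ x y, r a x y ↔ r b x y) : a = b :=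
  A.representable.choose_spec.choose_spec.1 (Set.ext fun p => h p.1 p.2)

theorem r_func {a : A.carrier} {x y z : A.Pt} (h₁ : r a x y) (h₂ : r a x z) : y = z :=
  A.representable.choose_spec.choose_spec.2.1 a x y z h₁ h₂

theorem r_comp {a b : A.carrier} {x z : A.Pt} :
    r (A.comp a b) x z ↔ ∃ y, r a x y ∧ r b y z :=
  Set.ext_iff.1 (A.representable.choose_spec.choose_spec.2.2.1 a b) (x, z)

theorem r_anti {a : A.carrier} {x y : A.Pt} : r (A.anti a) x y ↔ x = y ∧ ∀ z, ¬ r a x z :=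
  (Set.ext_iff.1 (A.representable.choose_spec.choose_spec.2.2.2.1 a) (x, y)).trans
    (and_congr_right fun _ => not_exists)

theorem r_ran {a : A.carrier} {x y : A.Pt} : r (A.ran a) x y ↔ x = y ∧ ∃ z, r a z x :=
  Set.ext_iff.1 (A.representable.choose_spec.choose_spec.2.2.2.2.1 a) (x, y)

theorem r_pref {a b : A.carrier} {x y : A.Pt} :
    r (A.pref a b) x y ↔ r a x y ∨ ((∀ z, ¬ r a x z) ∧ r b x y) :=
  (Set.ext_iff.1 (A.representable.choose_spec.choose_spec.2.2.2.2.2 a b) (x, y)).trans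
    (or_congr_right (and_congr_left fun _ => not_exists))

theorem r_dom {a : A.carrier} {x y : A.Pt} : r (A.dom a) x y ↔ x = y ∧ ∃ z, r a x z := by
  simp only [dom, r_anti]
  constructor
  · rintro ⟨h, h'⟩
    refine ⟨h, ?_⟩
    by_contra hc
    exact h' x ⟨rfl, fun z hz => hc ⟨z, hz⟩⟩
  · rintro ⟨h, z, hz⟩
    exact ⟨h, fun w hw => hw.2 z hz⟩

/-- With this, every algebraic inequality or identity below is checked on points of the
representation instead of being derived from axioms. -/
theorem le_iff {a b : A.carrier} : A.le a b ↔ ∀ x y, r a x y → r b x y := by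
  constructor
  · intro h x y hxy
    rw [le] at h
    rw [← h, r_comp] at hxy
    obtain ⟨z, hz, hb⟩ := hxy
    rw [r_dom] at hz
    exact hz.1 ▸ hb
  · intro h
    refine r_ext fun x y => ?_
    rw [r_comp]
    constructor
    · rintro ⟨z, hz, hb⟩
      obtain ⟨rfl, w, hw⟩ := r_dom.1 hz
      exact r_func (h _ _ hw) hb ▸ hw
    · exact fun hxy => ⟨x, r_dom.2 ⟨rfl, y, hxy⟩, h _ _ hxy⟩

theorem le_refl (a : A.carrier) : A.le a a := le_iff.2 fun _ _ h => h

theorem le_trans {a b c : A.carrier} (h : A.le a b) (h' : A.le b c) : A.le a c :=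
  le_iff.2 fun _ _ hxy => le_iff.1 h' _ _ (le_iff.1 h _ _ hxy)

theorem le_antisymm {a b : A.carrier} (h : A.le a b) (h' : A.le b a) : a = b :=
  r_ext fun x y => ⟨le_iff.1 h x y, le_iff.1 h' x y⟩

theorem mem_domElts {a : A.carrier} : a ∈ A.domElts ↔ ∀ x y, r a x y → x = y := by
  constructor
  · rintro ⟨b, rfl⟩ x y h
    exact (r_anti.1 h).1
  · intro h
    refine ⟨A.anti a, r_ext fun x y => ?_⟩
    change r (A.dom a) x y ↔ _
    rw [r_dom]
    constructor
    · rintro ⟨rfl, z, hz⟩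
      exact (h _ _ hz) ▸ hz
    · exact fun hxy => ⟨h _ _ hxy, y, hxy⟩

theorem anti_mem_domElts (a : A.carrier) : A.anti a ∈ A.domElts := ⟨a, rfl⟩

theorem dom_mem_domElts (a : A.carrier) : A.dom a ∈ A.domElts := ⟨A.anti a, rfl⟩

theorem ran_mem_domElts (a : A.carrier) : A.ran a ∈ A.domElts :=
  mem_domElts.2 fun _ _ h => (r_ran.1 h).1

theorem comp_mem_domElts {a b : A.carrier} (ha : a ∈ A.domElts) (hb : b ∈ A.domElts) :
    A.comp a b ∈ A.domElts := by
  refine mem_domElts.2 fun x y h => ?_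
  obtain ⟨z, h₁, h₂⟩ := r_comp.1 h
  exact (mem_domElts.1 ha _ _ h₁).trans (mem_domElts.1 hb _ _ h₂)

theorem dom_eq_self {α : A.carrier} (hα : α ∈ A.domElts) : A.dom α = α := by
  refine r_ext fun x y => ?_
  rw [r_dom]
  constructor
  · rintro ⟨rfl, z, hz⟩
    exact (mem_domElts.1 hα _ _ hz) ▸ hz
  · exact fun h => ⟨mem_domElts.1 hα _ _ h, y, h⟩

theorem r_restrict {α a : A.carrier} (hα : α ∈ A.domElts) {x y : A.Pt} :
    r (A.comp α a) x y ↔ r α x x ∧ r a x y := by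
  rw [r_comp]
  constructor
  · rintro ⟨z, h₁, h₂⟩
    obtain rfl := mem_domElts.1 hα _ _ h₁
    exact ⟨h₁, h₂⟩
  · exact fun h => ⟨x, h⟩

theorem r_corestrict {a β : A.carrier} (hβ : β ∈ A.domElts) {x y : A.Pt} :
    r (A.comp a β) x y ↔ r a x y ∧ r β y y := by
  rw [r_comp]
  constructor
  · rintro ⟨z, h₁, h₂⟩
    obtain rfl := mem_domElts.1 hβ _ _ h₂
    exact ⟨h₁, h₂⟩
  · exact fun h => ⟨y, h⟩

theorem le_of_mem_domElts {α β : A.carrier} (hα : α ∈ A.domElts)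
    (h : ∀ x, r α x x → r β x x) : A.le α β :=
  le_iff.2 fun x y hxy => by
    obtain rfl := mem_domElts.1 hα _ _ hxy
    exact h _ hxy

theorem comp_mono {a a' b b' : A.carrier} (h : A.le a a') (h' : A.le b b') :
    A.le (A.comp a b) (A.comp a' b') :=
  le_iff.2 fun x y hxy => by
    obtain ⟨z, h₁, h₂⟩ := r_comp.1 hxy
    exact r_comp.2 ⟨z, le_iff.1 h _ _ h₁, le_iff.1 h' _ _ h₂⟩

theorem dom_mono {a b : A.carrier} (h : A.le a b) : A.le (A.dom a) (A.dom b) :=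
  le_iff.2 fun x y hxy => by
    obtain ⟨rfl, z, hz⟩ := r_dom.1 hxy
    exact r_dom.2 ⟨rfl, z, le_iff.1 h _ _ hz⟩

variable (A) in
/-- The empty partial function. -/
noncomputable def zero : A.carrier := A.comp (A.anti A.nonempty.some) A.nonempty.some

theorem not_r_zero {x y : A.Pt} : ¬ r A.zero x y := by
  rw [zero, r_restrict (anti_mem_domElts _), r_anti]
  exact fun h => h.1.2 _ h.2

theorem eq_zero_of_forall {a : A.carrier} (h : ∀ x y, ¬ r a x y) : a = A.zero :=
  r_ext fun x y => iff_of_false (h x y) not_r_zero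

theorem zero_le (a : A.carrier) : A.le A.zero a := le_iff.2 fun _ _ h => (not_r_zero h).elim

variable (A) in
/-- The identity function. -/
noncomputable def one : A.carrier := A.anti A.zero

theorem r_one {x y : A.Pt} : r A.one x y ↔ x = y := by
  rw [one, r_anti]
  exact and_iff_left fun _ => not_r_zero

theorem one_mem_domElts : A.one ∈ A.domElts := anti_mem_domElts _

end Representation

/-! ### Ultrafilters of domain elements as traces of ultrafilters on the base set. -/

section Ultrafilter

variable {A : FunctionAlgebra.{u}}

namespace IsDomUltrafilter

variable {μ ν : Set A.carrier}

theorem mem_of_r (hμ : A.IsDomUltrafilter μ) {α β : A.carrier} (hα : α ∈ μ) (hβ : β ∈ A.domElts)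
    (h : ∀ x, r α x x → r β x x) : β ∈ μ :=
  hμ.upward α β hα hβ (le_of_mem_domElts (hμ.subset hα) h)

theorem exists_r (hμ : A.IsDomUltrafilter μ) {α : A.carrier} (hα : α ∈ μ) : ∃ x, r α x x := by
  by_contra hc
  push Not at hc
  refine (hμ.ultra α (hμ.subset hα)).1 (hμ.mem_of_r hα (anti_mem_domElts _) fun x hx => ?_) hα
  exact (hc x hx).elim

/-- Maximality; thanks to it, equalities of sources and targets below need only one inclusion. -/
theorem eq_of_subset (hμ : A.IsDomUltrafilter μ) (hν : A.IsDomUltrafilter ν) (h : μ ⊆ ν) :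
    μ = ν := by
  refine h.antisymm fun α hα => ?_
  by_contra hc
  exact (hν.ultra α (hν.subset hα)).1 (h ((hμ.ultra α (hν.subset hα)).2 hc)) hα

theorem one_mem (hμ : A.IsDomUltrafilter μ) : A.one ∈ μ := by
  obtain ⟨α, hα⟩ := hμ.nonempty
  exact hμ.mem_of_r hα one_mem_domElts fun x _ => r_one.2 rfl

end IsDomUltrafilter

/-- The trace on the domain elements of an ultrafilter on the base of the representation. -/
def traceUltrafilter (𝒰 : Ultrafilter A.Pt) : Set A.carrier :=
  {α | α ∈ A.domElts ∧ {x | r α x x} ∈ 𝒰}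

theorem isDomUltrafilter_trace (𝒰 : Ultrafilter A.Pt) :
    A.IsDomUltrafilter (traceUltrafilter 𝒰) where
  subset _ h := h.1
  nonempty := ⟨A.one, one_mem_domElts, Filter.univ_mem' fun _ => r_one.2 rfl⟩
  upward α β hα hβ h := ⟨hβ, Filter.mem_of_superset hα.2 fun x hx => le_iff.1 h _ _ hx⟩
  meet α β hα hβ := by
    refine ⟨comp_mem_domElts hα.1 hβ.1, Filter.mem_of_superset (Filter.inter_mem hα.2 hβ.2) ?_⟩
    exact fun x hx => (r_restrict hα.1).2 hx
  ultra α hα := by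
    have : {x | r (A.anti α) x x} = {x | r α x x}ᶜ := by
      ext x
      simp only [Set.mem_ofPred_eq, Set.mem_compl_iff, r_anti, true_and]
      refine ⟨fun h => h x, fun h z hz => h ?_⟩
      have := mem_domElts.1 hα _ _ hz
      exact this ▸ hz
    simp only [traceUltrafilter, Set.mem_ofPred_eq, anti_mem_domElts, true_and, hα, this,
      Ultrafilter.compl_mem_iff_notMem]

/-- The sets of fixed points of members of `S` are nonempty and downward directed, so they generate
a proper filter on the base, which extends to an ultrafilter. -/
theorem exists_trace_superset {S : Set A.carrier} (hS : S ⊆ A.domElts) (hne : S.Nonempty)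
    (hr : ∀ α ∈ S, ∃ x, r α x x)
    (hmeet : ∀ α ∈ S, ∀ β ∈ S, ∃ γ ∈ S, A.le γ (A.comp α β)) :
    ∃ 𝒰 : Ultrafilter A.Pt, S ⊆ traceUltrafilter 𝒰 := by
  have : Nonempty S := hne.to_subtype
  let f : S → Filter A.Pt := fun α => Filter.principal {x | r α.1 x x}
  have hdir : Directed (· ≥ ·) f := by
    rintro ⟨α, hα⟩ ⟨β, hβ⟩
    obtain ⟨γ, hγ, h⟩ := hmeet α hα β hβ
    have key : ∀ x, r γ x x → r α x x ∧ r β x x := fun x hx =>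
      (r_restrict (hS hα)).1 (le_iff.1 h _ _ hx)
    exact ⟨⟨γ, hγ⟩, Filter.principal_mono.2 fun x hx => (key x hx).1,
      Filter.principal_mono.2 fun x hx => (key x hx).2⟩
  have hbot : (⨅ α, f α).NeBot := Filter.iInf_neBot_of_directed' hdir fun α =>
    Filter.principal_neBot_iff.2 (hr α.1 α.2)
  refine ⟨Ultrafilter.of (⨅ α, f α), fun α hα => ⟨hS hα, ?_⟩⟩
  exact Ultrafilter.of_le _ (Filter.mem_iInf_of_mem ⟨α, hα⟩ (Filter.mem_principal_self _))

theorem exists_trace_eq {μ : Set A.carrier} (hμ : A.IsDomUltrafilter μ) :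
    ∃ 𝒰 : Ultrafilter A.Pt, traceUltrafilter 𝒰 = μ := by
  obtain ⟨𝒰, h⟩ := exists_trace_superset hμ.subset hμ.nonempty (fun α hα => hμ.exists_r hα)
    fun α hα β hβ => ⟨_, hμ.meet α β hα hβ, le_refl _⟩
  exact ⟨𝒰, (hμ.eq_of_subset (isDomUltrafilter_trace 𝒰) h).symm⟩

end Ultrafilter

/-! ### Germs at an ultrafilter are prime filters. -/

section Germ

variable {A : FunctionAlgebra.{u}}

/-- The germ of `a` at `μ`: the elements above a restriction of `a` to a member of `μ`. -/
def germ (μ : Set A.carrier) (a : A.carrier) : Set A.carrier :=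
  {b | ∃ α ∈ μ, A.le (A.comp α a) b}

variable {μ : Set A.carrier} {a b : A.carrier}

theorem mem_germ (hμ : A.IsDomUltrafilter μ) :
    b ∈ germ μ a ↔ ∃ α ∈ μ, ∀ x y, r α x x → r a x y → r b x y := by
  refine exists_congr fun α => and_congr_right fun hα => ?_
  simp only [le_iff, r_restrict (hμ.subset hα), and_imp]

theorem self_mem_germ (hμ : A.IsDomUltrafilter μ) : a ∈ germ μ a :=
  (mem_germ hμ).2 ⟨A.one, hμ.one_mem, fun _ _ _ h => h⟩

theorem dom_mem_of_mem_germ (hμ : A.IsDomUltrafilter μ) (ha : A.dom a ∈ μ) (hb : b ∈ germ μ a) :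
    A.dom b ∈ μ := by
  obtain ⟨α, hα, h⟩ := (mem_germ hμ).1 hb
  refine hμ.mem_of_r (hμ.meet _ _ hα ha) (dom_mem_domElts _) fun x hx => ?_
  obtain ⟨h₁, h₂⟩ := (r_restrict (hμ.subset hα)).1 hx
  obtain ⟨-, y, hy⟩ := r_dom.1 h₂
  exact r_dom.2 ⟨rfl, y, h _ _ h₁ hy⟩

theorem isPrimeFilter_germ (hμ : A.IsDomUltrafilter μ) (ha : A.dom a ∈ μ) :
    A.IsPrimeFilter (germ μ a) where
  nonempty := ⟨a, self_mem_germ hμ⟩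
  upward := fun b c ⟨α, hα, h⟩ hbc => ⟨α, hα, le_trans h hbc⟩
  directed := fun b c ⟨α, hα, h⟩ ⟨β, hβ, h'⟩ => by
    refine ⟨A.comp (A.comp α β) a, ⟨_, hμ.meet _ _ hα hβ, le_refl _⟩, le_trans ?_ h,
      le_trans ?_ h'⟩
    · refine comp_mono (le_iff.2 fun x y hxy => ?_) (le_refl _)
      exact ((r_corestrict (hμ.subset hβ)).1 hxy).1
    · refine comp_mono (le_iff.2 fun x y hxy => ?_) (le_refl _)
      exact ((r_restrict (hμ.subset hα)).1 hxy).2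
  proper := by
    intro h
    have h0 : A.zero ∈ germ μ a := h ▸ Set.mem_univ _
    obtain ⟨x, hx⟩ := hμ.exists_r (dom_mem_of_mem_germ hμ ha h0)
    obtain ⟨-, z, hz⟩ := r_dom.1 hx
    exact not_r_zero hz
  prime := by
    intro b c h
    obtain ⟨α, hα, h⟩ := (mem_germ hμ).1 h
    -- Primeness comes from `μ` deciding `D(b)`: on `D(b)` the preferential union equals `b`, off it
    -- `c`.
    by_cases hb : A.dom b ∈ μ
    · left
      refine (mem_germ hμ).2 ⟨_, hμ.meet _ _ hα hb, fun x y hx hxy => ?_⟩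
      obtain ⟨h₁, h₂⟩ := (r_restrict (hμ.subset hα)).1 hx
      obtain ⟨-, z, hz⟩ := r_dom.1 h₂
      rcases r_pref.1 (h x y h₁ hxy) with h | h
      · exact h
      · exact (h.1 z hz).elim
    · right
      refine (mem_germ hμ).2 ⟨_, hμ.meet _ _ hα ((hμ.ultra _ (dom_mem_domElts _)).2 hb),
        fun x y hx hxy => ?_⟩
      obtain ⟨h₁, h₂⟩ := (r_restrict (hμ.subset hα)).1 hx
      rcases r_pref.1 (h x y h₁ hxy) with h | h
      · exact ((r_anti.1 h₂).2 x (r_dom.2 ⟨rfl, y, h⟩)).elim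
      · exact h.2

end Germ

/-! ### Every prime filter is a germ. -/

namespace IsPrimeFilter

variable {A : FunctionAlgebra.{u}} {P Q : Set A.carrier} {a b α β : A.carrier}

theorem zero_notMem (hP : A.IsPrimeFilter P) : A.zero ∉ P := fun h =>
  hP.proper (Set.eq_univ_of_forall fun a => hP.upward _ a h (zero_le a))

theorem mem_of_r (hP : A.IsPrimeFilter P) (ha : a ∈ P) (h : ∀ x y, r a x y → r b x y) : b ∈ P :=
  hP.upward a b ha (le_iff.2 h)

/-- `a` is the preferential union of its restrictions to `α` and to the complement of `α`. -/
theorem restrict_or (hP : A.IsPrimeFilter P) (ha : a ∈ P) (hα : α ∈ A.domElts) :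
    A.comp α a ∈ P ∨ A.comp (A.anti α) a ∈ P := by
  refine hP.prime _ _ (hP.mem_of_r ha fun x y hxy => ?_)
  rw [r_pref, r_restrict hα, r_restrict (anti_mem_domElts _)]
  by_cases h : r α x x
  · exact Or.inl ⟨h, hxy⟩
  · refine Or.inr ⟨fun z hz => h ((r_restrict hα).1 hz).1, r_anti.2 ⟨rfl, fun z hz => h ?_⟩, hxy⟩
    have := mem_domElts.1 hα _ _ hz
    exact this ▸ hz

theorem isDomUltrafilter_dom (hP : A.IsPrimeFilter P) : A.IsDomUltrafilter (A.dom '' P) := by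
  have hup : ∀ α β, α ∈ A.dom '' P → β ∈ A.domElts → A.le α β → β ∈ A.dom '' P := by
    rintro _ β ⟨a, ha, rfl⟩ hβ h
    -- Since `D(a) ≤ β`, this element lies above `a` and has domain exactly `β`.
    refine ⟨A.pref a β, hP.mem_of_r ha fun x y hxy => r_pref.2 (Or.inl hxy), ?_⟩
    refine r_ext fun x y => ?_
    rw [r_dom]
    constructor
    · rintro ⟨rfl, z, hz⟩
      rcases r_pref.1 hz with hz | ⟨-, hz⟩
      · exact le_iff.1 h _ _ (r_dom.2 ⟨rfl, z, hz⟩)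
      · have := mem_domElts.1 hβ _ _ hz
        exact this ▸ hz
    · intro hxy
      refine ⟨mem_domElts.1 hβ _ _ hxy, ?_⟩
      by_cases hx : ∃ z, r a x z
      · obtain ⟨z, hz⟩ := hx
        exact ⟨z, r_pref.2 (Or.inl hz)⟩
      · exact ⟨y, r_pref.2 (Or.inr ⟨fun z hz => hx ⟨z, hz⟩, hxy⟩)⟩
  have hmeet : ∀ α β, α ∈ A.dom '' P → β ∈ A.dom '' P → A.comp α β ∈ A.dom '' P := by
    rintro _ _ ⟨a, ha, rfl⟩ ⟨b, hb, rfl⟩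
    obtain ⟨c, hc, hca, hcb⟩ := hP.directed a b ha hb
    refine hup _ _ ⟨c, hc, rfl⟩ (comp_mem_domElts (dom_mem_domElts _) (dom_mem_domElts _)) ?_
    refine le_iff.2 fun x y hxy => (r_restrict (dom_mem_domElts _)).2 ⟨?_, ?_⟩
    · obtain ⟨rfl, -⟩ := r_dom.1 hxy
      exact le_iff.1 (dom_mono hca) _ _ hxy
    · exact le_iff.1 (dom_mono hcb) _ _ hxy
  refine ⟨?_, hP.nonempty.image _, hup, hmeet, fun α hα => ⟨fun h h' => ?_, fun h => ?_⟩⟩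
  · rintro _ ⟨a, -, rfl⟩
    exact dom_mem_domElts a
  · obtain ⟨c, hc, hc'⟩ := hmeet _ _ h' h
    have : c = A.zero := eq_zero_of_forall fun x y hxy => by
      have hx : r (A.dom c) x x := r_dom.2 ⟨rfl, y, hxy⟩
      rw [hc', r_restrict hα, r_anti] at hx
      exact hx.2.2 x hx.1
    exact hP.zero_notMem (this ▸ hc)
  · obtain ⟨a, ha⟩ := hP.nonempty
    rcases hP.restrict_or ha hα with h' | h'
    · refine (h (hup _ _ ⟨_, h', rfl⟩ hα
        (le_of_mem_domElts (dom_mem_domElts _) fun x hx => ?_))).elim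
      obtain ⟨-, z, hz⟩ := r_dom.1 hx
      exact ((r_restrict hα).1 hz).1
    · refine hup _ _ ⟨_, h', rfl⟩ (anti_mem_domElts _)
        (le_of_mem_domElts (dom_mem_domElts _) fun x hx => ?_)
      obtain ⟨-, z, hz⟩ := r_dom.1 hx
      exact ((r_restrict (anti_mem_domElts _)).1 hz).1

theorem dom_mem (ha : a ∈ P) : A.dom a ∈ A.dom '' P := ⟨a, ha, rfl⟩

theorem restrict_mem (hP : A.IsPrimeFilter P) (hα : α ∈ A.dom '' P) (ha : a ∈ P) :
    A.comp α a ∈ P := by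
  obtain ⟨p, hp, rfl⟩ := hα
  obtain ⟨c, hc, hcp, hca⟩ := hP.directed p a hp ha
  refine hP.mem_of_r hc fun x y hxy => (r_restrict (dom_mem_domElts _)).2 ⟨?_, ?_⟩
  · exact r_dom.2 ⟨rfl, y, le_iff.1 hcp _ _ hxy⟩
  · exact le_iff.1 hca _ _ hxy

/-- Two members of `P` agree on the domain of a common lower bound, and that domain belongs to the
source. -/
theorem eq_germ (hP : A.IsPrimeFilter P) (ha : a ∈ P) : P = germ (A.dom '' P) a := by
  refine Set.Subset.antisymm (fun b hb => ?_) ?_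
  · obtain ⟨c, hc, hca, hcb⟩ := hP.directed a b ha hb
    refine (mem_germ hP.isDomUltrafilter_dom).2 ⟨_, dom_mem hc, fun x y hx hxy => ?_⟩
    obtain ⟨-, z, hz⟩ := r_dom.1 hx
    rw [r_func hxy (le_iff.1 hca _ _ hz)]
    exact le_iff.1 hcb _ _ hz
  · rintro b ⟨α, hα, h⟩
    exact hP.upward _ _ (hP.restrict_mem hα ha) h

theorem eq_of_subset (hP : A.IsPrimeFilter P) (hQ : A.IsPrimeFilter Q) (h : P ⊆ Q) : P = Q := by
  obtain ⟨a, ha⟩ := hP.nonempty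
  rw [hP.eq_germ ha, hQ.eq_germ (h ha), hP.isDomUltrafilter_dom.eq_of_subset
    hQ.isDomUltrafilter_dom (Set.image_mono h)]

theorem eq_of_mem (hP : A.IsPrimeFilter P) (hQ : A.IsPrimeFilter Q) (h : A.dom '' P = A.dom '' Q)
    (ha : a ∈ P) (hb : a ∈ Q) : P = Q := by
  rw [hP.eq_germ ha, hQ.eq_germ hb, h]

end IsPrimeFilter

/-! ### Source, target, identities and composition of prime filters. -/

section Structure

variable {A : FunctionAlgebra.{u}} {P Q : Set A.carrier} {a b α β : A.carrier}

theorem dom_image_germ {μ : Set A.carrier} (hμ : A.IsDomUltrafilter μ) (ha : A.dom a ∈ μ) :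
    A.dom '' germ μ a = μ := by
  refine (isPrimeFilter_germ hμ ha).isDomUltrafilter_dom.eq_of_subset hμ ?_
  rintro _ ⟨b, hb, rfl⟩
  exact dom_mem_of_mem_germ hμ ha hb

/-- The upward closure, in the domain elements, of the ranges of the members of `P`. -/
def tgtSet (P : Set A.carrier) : Set A.carrier :=
  {α | α ∈ A.domElts ∧ ∃ a ∈ P, A.le (A.ran a) α}

/-- Membership in the target is tested on one fixed member of `P`, which turns statements about
targets into statements about `P`. -/
theorem mem_tgtSet (hP : A.IsPrimeFilter P) (ha : a ∈ P) (hβ : β ∈ A.domElts) :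
    β ∈ tgtSet P ↔ A.comp a β ∈ P := by
  constructor
  · rintro ⟨-, b, hb, h⟩
    obtain ⟨c, hc, hca, hcb⟩ := hP.directed a b ha hb
    refine hP.mem_of_r hc fun x y hxy => (r_corestrict hβ).2 ⟨le_iff.1 hca _ _ hxy, ?_⟩
    exact le_iff.1 h _ _ (r_ran.2 ⟨rfl, x, le_iff.1 hcb _ _ hxy⟩)
  · refine fun h => ⟨hβ, _, h, le_of_mem_domElts (ran_mem_domElts _) fun y hy => ?_⟩
    obtain ⟨-, x, hx⟩ := r_ran.1 hy
    exact ((r_corestrict hβ).1 hx).2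

theorem ran_mem_tgtSet (ha : a ∈ P) : A.ran a ∈ tgtSet P := ⟨ran_mem_domElts a, a, ha, le_refl _⟩

theorem isDomUltrafilter_tgtSet (hP : A.IsPrimeFilter P) : A.IsDomUltrafilter (tgtSet P) := by
  obtain ⟨a, ha⟩ := hP.nonempty
  refine ⟨fun _ h => h.1, ⟨_, ran_mem_tgtSet ha⟩, fun α β ⟨_, b, hb, h⟩ hβ hαβ =>
    ⟨hβ, b, hb, le_trans h hαβ⟩, fun α β hα hβ => ?_, fun α hα => ?_⟩
  · refine (mem_tgtSet hP ha (comp_mem_domElts hα.1 hβ.1)).2 (hP.mem_of_r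
      ((mem_tgtSet hP ((mem_tgtSet hP ha hα.1).1 hα) hβ.1).1 hβ) fun x y hxy => ?_)
    obtain ⟨h₁, h₂⟩ := (r_corestrict hβ.1).1 hxy
    obtain ⟨h₁, h₃⟩ := (r_corestrict hα.1).1 h₁
    exact (r_corestrict (comp_mem_domElts hα.1 hβ.1)).2 ⟨h₁, (r_restrict hα.1).2 ⟨h₃, h₂⟩⟩
  · constructor
    · intro h h'
      rw [mem_tgtSet hP ((mem_tgtSet hP ha hα).1 h') (anti_mem_domElts _)] at h
      refine hP.zero_notMem ((eq_zero_of_forall fun x y hxy => ?_) ▸ h)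
      obtain ⟨h₁, h₂⟩ := (r_corestrict (anti_mem_domElts _)).1 hxy
      exact (r_anti.1 h₂).2 y ((r_corestrict hα).1 h₁).2
    · intro h
      rw [mem_tgtSet hP ha hα] at h
      rw [mem_tgtSet hP ha (anti_mem_domElts _)]
      -- Split `a` by whether its value lands in `α`. The first half would put `a ; α` in `P`; the
      -- second half lies below `a ; A(α)`.
      rcases hP.restrict_or ha (dom_mem_domElts (A.comp a α)) with h' | h'
      · refine (h (hP.mem_of_r h' fun x y hxy => ?_)).elim
        obtain ⟨h₁, h₂⟩ := (r_restrict (dom_mem_domElts _)).1 hxy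
        obtain ⟨-, z, hz⟩ := r_dom.1 h₁
        rw [r_func h₂ ((r_corestrict hα).1 hz).1]
        exact hz
      · refine hP.mem_of_r h' fun x y hxy => ?_
        obtain ⟨h₁, h₂⟩ := (r_restrict (anti_mem_domElts _)).1 hxy
        refine (r_corestrict (anti_mem_domElts _)).2 ⟨h₂, r_anti.2 ⟨rfl, fun z hz => ?_⟩⟩
        have := mem_domElts.1 hα _ _ hz
        refine (r_anti.1 h₁).2 x (r_dom.2 ⟨rfl, z, (r_corestrict hα).2 ⟨this ▸ h₂, ?_⟩⟩)
        exact this ▸ hz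

/-- The upward closure of the set of products. -/
def compSet (P Q : Set A.carrier) : Set A.carrier :=
  {c | ∃ a ∈ P, ∃ b ∈ Q, A.le (A.comp a b) c}

theorem dom_comp_mem (hP : A.IsPrimeFilter P) (hPQ : tgtSet P = A.dom '' Q) (ha : a ∈ P)
    (hb : b ∈ Q) : A.dom (A.comp a b) ∈ A.dom '' P := by
  have h : A.comp a (A.dom b) ∈ P :=
    (mem_tgtSet hP ha (dom_mem_domElts b)).1 (hPQ ▸ IsPrimeFilter.dom_mem hb)
  refine hP.isDomUltrafilter_dom.mem_of_r (IsPrimeFilter.dom_mem h) (dom_mem_domElts _)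
    fun x hx => ?_
  obtain ⟨-, y, hy⟩ := r_dom.1 hx
  obtain ⟨h₁, h₂⟩ := (r_corestrict (dom_mem_domElts _)).1 hy
  obtain ⟨-, z, hz⟩ := r_dom.1 h₂
  exact r_dom.2 ⟨rfl, z, r_comp.2 ⟨y, h₁, hz⟩⟩

/-- Lower bounds of `a, p` in `P` and of `b, q` in `Q` show that all products have the same germ at
the source of `P`. -/
theorem compSet_eq_germ (hP : A.IsPrimeFilter P) (hQ : A.IsPrimeFilter Q)
    (hPQ : tgtSet P = A.dom '' Q) (ha : a ∈ P) (hb : b ∈ Q) :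
    compSet P Q = germ (A.dom '' P) (A.comp a b) := by
  have hμ := hP.isDomUltrafilter_dom
  ext c
  constructor
  · rintro ⟨p, hp, q, hq, h⟩
    obtain ⟨a', ha', haa, hap⟩ := hP.directed a p ha hp
    obtain ⟨b', hb', hbb, hbq⟩ := hQ.directed b q hb hq
    refine (mem_germ hμ).2 ⟨_, dom_comp_mem hP hPQ ha' hb', fun x z hx hxz => ?_⟩
    obtain ⟨-, z', hz'⟩ := r_dom.1 hx
    rw [r_func hxz (le_iff.1 (comp_mono haa hbb) _ _ hz')]
    exact le_iff.1 h _ _ (le_iff.1 (comp_mono hap hbq) _ _ hz')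
  · rintro ⟨α, hα, h⟩
    refine ⟨_, hP.restrict_mem hα ha, b, hb, le_trans (le_iff.2 fun x y hxy => ?_) h⟩
    obtain ⟨z, h₁, h₂⟩ := r_comp.1 hxy
    obtain ⟨h₁, h₃⟩ := (r_restrict (hμ.subset hα)).1 h₁
    exact (r_restrict (hμ.subset hα)).2 ⟨h₁, r_comp.2 ⟨z, h₃, h₂⟩⟩

theorem isPrimeFilter_compSet (hP : A.IsPrimeFilter P) (hQ : A.IsPrimeFilter Q)
    (hPQ : tgtSet P = A.dom '' Q) : A.IsPrimeFilter (compSet P Q) := by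
  obtain ⟨a, ha⟩ := hP.nonempty
  obtain ⟨b, hb⟩ := hQ.nonempty
  rw [compSet_eq_germ hP hQ hPQ ha hb]
  exact isPrimeFilter_germ hP.isDomUltrafilter_dom (dom_comp_mem hP hPQ ha hb)

theorem comp_mem_compSet (ha : a ∈ P) (hb : b ∈ Q) : A.comp a b ∈ compSet P Q :=
  ⟨a, ha, b, hb, le_refl _⟩

theorem dom_image_compSet (hP : A.IsPrimeFilter P) (hQ : A.IsPrimeFilter Q)
    (hPQ : tgtSet P = A.dom '' Q) : A.dom '' compSet P Q = A.dom '' P := by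
  obtain ⟨a, ha⟩ := hP.nonempty
  obtain ⟨b, hb⟩ := hQ.nonempty
  rw [compSet_eq_germ hP hQ hPQ ha hb]
  exact dom_image_germ hP.isDomUltrafilter_dom (dom_comp_mem hP hPQ ha hb)

theorem tgtSet_compSet (hP : A.IsPrimeFilter P) (hQ : A.IsPrimeFilter Q)
    (hPQ : tgtSet P = A.dom '' Q) : tgtSet (compSet P Q) = tgtSet Q := by
  refine ((isDomUltrafilter_tgtSet hQ).eq_of_subset
    (isDomUltrafilter_tgtSet (isPrimeFilter_compSet hP hQ hPQ)) ?_).symm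
  rintro β ⟨hβ, b, hb, h⟩
  obtain ⟨a, ha⟩ := hP.nonempty
  refine ⟨hβ, _, comp_mem_compSet ha hb, le_trans (le_iff.2 fun x y hxy => ?_) h⟩
  obtain ⟨rfl, z, hz⟩ := r_ran.1 hxy
  obtain ⟨w, -, hw⟩ := r_comp.1 hz
  exact r_ran.2 ⟨rfl, w, hw⟩

theorem compSet_assoc {R : Set A.carrier} :
    compSet (compSet P Q) R = compSet P (compSet Q R) := by
  have hassoc : ∀ a b c, A.comp (A.comp a b) c = A.comp a (A.comp b c) := fun a b c => by
    refine r_ext fun x y => ?_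
    simp only [r_comp]
    constructor
    · rintro ⟨z, ⟨w, h₁, h₂⟩, h₃⟩
      exact ⟨w, h₁, z, h₂, h₃⟩
    · rintro ⟨w, h₁, z, h₂, h₃⟩
      exact ⟨z, ⟨w, h₁, h₂⟩, h₃⟩
  ext d
  constructor
  · rintro ⟨e, ⟨a, ha, b, hb, he⟩, c, hc, h⟩
    exact ⟨a, ha, _, comp_mem_compSet hb hc,
      hassoc a b c ▸ le_trans (comp_mono he (le_refl c)) h⟩
  · rintro ⟨a, ha, e, ⟨b, hb, c, hc, he⟩, h⟩
    exact ⟨_, comp_mem_compSet ha hb, c, hc,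
      (hassoc a b c).symm ▸ le_trans (comp_mono (le_refl a) he) h⟩

/-- Equality of the composites puts `a ; c` in the germ of `a ; b`, so `b ≤ c` on the range of some
`α ; a` in `P`. That range lies in the target of `P`, which is the source of `Q`; hence `c ∈ Q`, and
`Q`, `R` share a source and a member. -/
theorem compSet_cancel {R : Set A.carrier} (hP : A.IsPrimeFilter P) (hQ : A.IsPrimeFilter Q)
    (hR : A.IsPrimeFilter R) (hPQ : tgtSet P = A.dom '' Q) (hPR : tgtSet P = A.dom '' R)
    (h : compSet P Q = compSet P R) : Q = R := by
  obtain ⟨a, ha⟩ := hP.nonempty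
  obtain ⟨b, hb⟩ := hQ.nonempty
  obtain ⟨c, hc⟩ := hR.nonempty
  have hμ := hP.isDomUltrafilter_dom
  have hcm : A.comp a c ∈ germ (A.dom '' P) (A.comp a b) := by
    rw [← compSet_eq_germ hP hQ hPQ ha hb, h]
    exact comp_mem_compSet ha hc
  obtain ⟨α, hα, H⟩ := (mem_germ hμ).1 hcm
  refine hQ.eq_of_mem hR (hPQ.symm.trans hPR) (a := c) ?_ hc
  rw [hQ.eq_germ hb, ← hPQ]
  refine (mem_germ (isDomUltrafilter_tgtSet hP)).2
    ⟨_, ran_mem_tgtSet (hP.restrict_mem hα ha), fun y z hy hyz => ?_⟩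
  obtain ⟨-, x, hx⟩ := r_ran.1 hy
  obtain ⟨h₁, h₂⟩ := (r_restrict (hμ.subset hα)).1 hx
  obtain ⟨y', h₃, h₄⟩ := r_comp.1 (H x z h₁ (r_comp.2 ⟨y, h₂, hyz⟩))
  exact r_func h₃ h₂ ▸ h₄

/-- The upward closure of `μ`. -/
def oneSet (μ : Set A.carrier) : Set A.carrier := {a | ∃ α ∈ μ, A.le α a}

variable {μ : Set A.carrier}

theorem oneSet_eq_germ : oneSet μ = germ μ A.one := by
  ext a
  refine exists_congr fun α => and_congr_right fun hα => ?_
  have : A.comp α A.one = α := r_ext fun x y => by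
    rw [r_corestrict one_mem_domElts]
    exact and_iff_left (r_one.2 rfl)
  rw [this]

theorem dom_one_mem (hμ : A.IsDomUltrafilter μ) : A.dom A.one ∈ μ :=
  (dom_eq_self one_mem_domElts).symm ▸ hμ.one_mem

theorem isPrimeFilter_oneSet (hμ : A.IsDomUltrafilter μ) : A.IsPrimeFilter (oneSet μ) :=
  oneSet_eq_germ ▸ isPrimeFilter_germ hμ (dom_one_mem hμ)

theorem dom_image_oneSet (hμ : A.IsDomUltrafilter μ) : A.dom '' oneSet μ = μ :=
  oneSet_eq_germ ▸ dom_image_germ hμ (dom_one_mem hμ)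

theorem subset_oneSet : μ ⊆ oneSet μ := fun α hα => ⟨α, hα, le_refl α⟩

theorem tgtSet_oneSet (hμ : A.IsDomUltrafilter μ) : tgtSet (oneSet μ) = μ := by
  refine (hμ.eq_of_subset (isDomUltrafilter_tgtSet (isPrimeFilter_oneSet hμ)) fun α hα =>
    ⟨hμ.subset hα, α, subset_oneSet hα, le_iff.2 fun x y hxy => ?_⟩).symm
  obtain ⟨rfl, z, hz⟩ := r_ran.1 hxy
  have := mem_domElts.1 (hμ.subset hα) _ _ hz
  exact this ▸ hz

theorem oneSet_compSet (hP : A.IsPrimeFilter P) : compSet (oneSet (A.dom '' P)) P = P := by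
  have hμ := hP.isDomUltrafilter_dom
  refine (hP.eq_of_subset (isPrimeFilter_compSet (isPrimeFilter_oneSet hμ) hP
    (tgtSet_oneSet hμ)) fun a ha => ?_).symm
  refine ⟨A.one, subset_oneSet hμ.one_mem, a, ha, le_iff.2 fun x y hxy => ?_⟩
  exact ((r_restrict one_mem_domElts).1 hxy).2

theorem compSet_oneSet (hP : A.IsPrimeFilter P) : compSet P (oneSet (tgtSet P)) = P := by
  have hν := isDomUltrafilter_tgtSet hP
  refine (hP.eq_of_subset (isPrimeFilter_compSet hP (isPrimeFilter_oneSet hν)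
    (dom_image_oneSet hν).symm) fun a ha => ?_).symm
  refine ⟨a, ha, A.one, subset_oneSet hν.one_mem, le_iff.2 fun x y hxy => ?_⟩
  exact ((r_corestrict one_mem_domElts).1 hxy).1

/-- The elements `D(a ; β)` for `β ∈ ν` are nonzero, as `R(a) ; β ∈ ν`, and directed. At any
ultrafilter containing them all, the germ of `a` contains every `a ; β`, so its target is `ν`. -/
theorem exists_tgtSet_eq {ν : Set A.carrier} (hν : A.IsDomUltrafilter ν) (ha : A.ran a ∈ ν) :
    ∃ P, A.IsPrimeFilter P ∧ a ∈ P ∧ tgtSet P = ν := by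
  obtain ⟨𝒰, h𝒰⟩ := exists_trace_superset (S := (fun β => A.dom (A.comp a β)) '' ν) (by
      rintro _ ⟨β, -, rfl⟩
      exact dom_mem_domElts _) (hν.nonempty.image _) (by
      rintro _ ⟨β, hβ, rfl⟩
      obtain ⟨y, hy⟩ := hν.exists_r (hν.meet _ _ ha hβ)
      obtain ⟨h₁, h₂⟩ := (r_restrict (ran_mem_domElts _)).1 hy
      obtain ⟨-, x, hx⟩ := r_ran.1 h₁
      exact ⟨x, r_dom.2 ⟨rfl, y, (r_corestrict (hν.subset hβ)).2 ⟨hx, h₂⟩⟩⟩) (by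
      rintro _ ⟨β, hβ, rfl⟩ _ ⟨γ, hγ, rfl⟩
      refine ⟨_, ⟨_, hν.meet _ _ hβ hγ, rfl⟩, le_of_mem_domElts (dom_mem_domElts _) fun x hx => ?_⟩
      obtain ⟨-, y, hy⟩ := r_dom.1 hx
      obtain ⟨h₁, h₂⟩ := (r_corestrict (comp_mem_domElts (hν.subset hβ) (hν.subset hγ))).1 hy
      obtain ⟨h₂, h₃⟩ := (r_restrict (hν.subset hβ)).1 h₂
      exact (r_restrict (dom_mem_domElts _)).2
        ⟨r_dom.2 ⟨rfl, y, (r_corestrict (hν.subset hβ)).2 ⟨h₁, h₂⟩⟩,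
          r_dom.2 ⟨rfl, y, (r_corestrict (hν.subset hγ)).2 ⟨h₁, h₃⟩⟩⟩)
  have hμ := isDomUltrafilter_trace 𝒰
  have hda : A.dom a ∈ traceUltrafilter 𝒰 := by
    refine hμ.mem_of_r (h𝒰 ⟨_, hν.one_mem, rfl⟩) (dom_mem_domElts _) fun x hx => ?_
    obtain ⟨-, y, hy⟩ := r_dom.1 hx
    exact r_dom.2 ⟨rfl, y, ((r_corestrict one_mem_domElts).1 hy).1⟩
  have hP := isPrimeFilter_germ hμ hda
  refine ⟨_, hP, self_mem_germ hμ, (hν.eq_of_subset (isDomUltrafilter_tgtSet hP)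
    fun β hβ => ?_).symm⟩
  rw [mem_tgtSet hP (self_mem_germ hμ) (hν.subset hβ)]
  refine (mem_germ hμ).2 ⟨_, h𝒰 ⟨β, hβ, rfl⟩, fun x y hx hxy => ?_⟩
  obtain ⟨-, z, hz⟩ := r_dom.1 hx
  rw [r_func hxy ((r_corestrict (hν.subset hβ)).1 hz).1]
  exact hz

end Structure

end FunctionAlgebra

theorem isLocalHomeomorph_of_continuous_isOpenMap_injOn {X Y : Type*} [TopologicalSpace X]
    [TopologicalSpace Y] {f : X → Y} (hc : Continuous f) (ho : IsOpenMap f)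
    (hi : ∀ x, ∃ U : Set X, IsOpen U ∧ x ∈ U ∧ Set.InjOn f U) : IsLocalHomeomorph f := by
  refine isLocalHomeomorph_iff_isOpenEmbedding_restrict.2 fun x => ?_
  obtain ⟨U, hU, hx, hinj⟩ := hi x
  exact ⟨U, hU.mem_nhds hx, .of_continuous_injective_isOpenMap
    (hc.comp continuous_subtype_val) (Set.injOn_iff_injective.1 hinj) (ho.domRestrict hU)⟩

namespace FunctionAlgebra

/-! ### Topologies on prime filters and on domain ultrafilters. -/

section Topology

variable (A : FunctionAlgebra.{u})

/-- The basic open set of prime filters containing `a`. -/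
def basicOpen (a : A.carrier) : Set A.PrimeFilters := {P | a ∈ P.1}

theorem isOpen_basicOpen (a : A.carrier) : IsOpen (A.basicOpen a) :=
  TopologicalSpace.isOpen_generateFrom_of_mem ⟨a, rfl⟩

theorem isTopologicalBasis_basicOpen :
    TopologicalSpace.IsTopologicalBasis (Set.range A.basicOpen) where
  exists_subset_inter := by
    rintro _ ⟨a, rfl⟩ _ ⟨b, rfl⟩ P ⟨ha, hb⟩
    obtain ⟨c, hc, hca, hcb⟩ := P.2.directed a b ha hb
    exact ⟨_, ⟨c, rfl⟩, hc, fun Q hQ => ⟨Q.2.upward _ _ hQ hca, Q.2.upward _ _ hQ hcb⟩⟩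
  sUnion_eq := Set.eq_univ_of_forall fun P => by
    obtain ⟨a, ha⟩ := P.2.nonempty
    exact ⟨_, ⟨a, rfl⟩, ha⟩
  eq_generateFrom := rfl

variable {A} in
theorem exists_basicOpen_subset {U : Set A.PrimeFilters} (hU : IsOpen U) {P : A.PrimeFilters}
    (hP : P ∈ U) : ∃ a ∈ P.1, A.basicOpen a ⊆ U := by
  obtain ⟨_, ⟨a, rfl⟩, ha, h⟩ := A.isTopologicalBasis_basicOpen.exists_subset_of_mem_open hP hU
  exact ⟨a, ha, h⟩

/-- The basic open set of ultrafilters containing `α`. -/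
def basicDom (α : A.carrier) : Set A.DomUltrafilters := {μ | α ∈ μ.1}

variable {A} in
theorem isOpen_basicDom {α : A.carrier} (hα : α ∈ A.domElts) : IsOpen (A.basicDom α) :=
  TopologicalSpace.isOpen_generateFrom_of_mem ⟨α, hα, rfl⟩

variable {A} in
theorem isClopen_basicDom {α : A.carrier} (hα : α ∈ A.domElts) : IsClopen (A.basicDom α) := by
  refine ⟨⟨?_⟩, isOpen_basicDom hα⟩
  convert isOpen_basicDom (anti_mem_domElts α) using 1
  ext μ
  exact (μ.2.ultra α hα).symm

instance : TotallySeparatedSpace A.DomUltrafilters := by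
  refine totallySeparatedSpace_iff_exists_isClopen.2 fun μ ν hne => ?_
  obtain ⟨α, hα, hα'⟩ : ∃ α ∈ μ.1, α ∉ ν.1 := by
    by_contra hc
    push Not at hc
    exact hne (Subtype.ext (μ.2.eq_of_subset ν.2 hc))
  exact ⟨_, isClopen_basicDom (μ.2.subset hα), hα, hα'⟩

/-- The trace map from ultrafilters on the base of the representation. -/
def trace (𝒰 : Ultrafilter A.Pt) : A.DomUltrafilters :=
  ⟨traceUltrafilter 𝒰, isDomUltrafilter_trace 𝒰⟩

theorem continuous_trace : Continuous A.trace := by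
  refine continuous_generateFrom_iff.2 ?_
  rintro _ ⟨α, hα, rfl⟩
  convert ultrafilter_isOpen_basic {x : A.Pt | r α x x} using 1
  ext 𝒰
  exact and_iff_right hα

/-- The space of ultrafilters on the base set is compact and `trace` maps it continuously onto this
one. -/
instance : CompactSpace A.DomUltrafilters := by
  have hs : Function.Surjective A.trace := fun μ => by
    obtain ⟨𝒰, h⟩ := exists_trace_eq μ.2
    exact ⟨𝒰, Subtype.ext h⟩
  exact hs.compactSpace A.continuous_trace

end Topology

/-! ### The Stone étale category of prime filters. -/

section Category

variable {A : FunctionAlgebra.{u}}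

/-- The source of a prime filter. -/
def srcPF (P : A.PrimeFilters) : A.DomUltrafilters := ⟨A.dom '' P.1, P.2.isDomUltrafilter_dom⟩

/-- The target of a prime filter. -/
def tgtPF (P : A.PrimeFilters) : A.DomUltrafilters := ⟨tgtSet P.1, isDomUltrafilter_tgtSet P.2⟩

/-- The identity prime filter. -/
def onePF (μ : A.DomUltrafilters) : A.PrimeFilters := ⟨oneSet μ.1, isPrimeFilter_oneSet μ.2⟩

/-- The composite of two prime filters. -/
def compPF (P Q : A.PrimeFilters) (h : tgtPF P = srcPF Q) : A.PrimeFilters :=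
  ⟨compSet P.1 Q.1, isPrimeFilter_compSet P.2 Q.2 (congrArg Subtype.val h)⟩

/-- The prime filter of germs of `a` at `μ`. -/
def germPF (μ : A.DomUltrafilters) (a : A.carrier) (h : A.dom a ∈ μ.1) : A.PrimeFilters :=
  ⟨germ μ.1 a, isPrimeFilter_germ μ.2 h⟩

theorem srcPF_germPF (μ : A.DomUltrafilters) (a : A.carrier) (h : A.dom a ∈ μ.1) :
    srcPF (germPF μ a h) = μ :=
  Subtype.ext (dom_image_germ μ.2 h)

theorem mem_germPF (μ : A.DomUltrafilters) (a : A.carrier) (h : A.dom a ∈ μ.1) :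
    a ∈ (germPF μ a h).1 :=
  self_mem_germ μ.2

theorem PrimeFilters.eq_of_subset {P Q : A.PrimeFilters} (h : P.1 ⊆ Q.1) : P = Q :=
  Subtype.ext (P.2.eq_of_subset Q.2 h)

theorem PrimeFilters.eq_of_mem {P Q : A.PrimeFilters} {a : A.carrier} (h : srcPF P = srcPF Q)
    (ha : a ∈ P.1) (hb : a ∈ Q.1) : P = Q :=
  Subtype.ext (P.2.eq_of_mem Q.2 (congrArg Subtype.val h) ha hb)

theorem injOn_srcPF (a : A.carrier) : Set.InjOn srcPF (A.basicOpen a) :=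
  fun _ hP _ hQ h => PrimeFilters.eq_of_mem h hP hQ

theorem srcPF_image_basicOpen (a : A.carrier) :
    srcPF '' A.basicOpen a = A.basicDom (A.dom a) := by
  ext μ
  constructor
  · rintro ⟨P, hP, rfl⟩
    exact IsPrimeFilter.dom_mem hP
  · exact fun h => ⟨germPF μ a h, mem_germPF _ _ h, srcPF_germPF _ _ _⟩

theorem tgtPF_image_basicOpen (a : A.carrier) :
    tgtPF '' A.basicOpen a = A.basicDom (A.ran a) := by
  ext μ
  constructor
  · rintro ⟨P, hP, rfl⟩
    exact ran_mem_tgtSet hP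
  · intro h
    obtain ⟨P, hP, ha, hμ⟩ := exists_tgtSet_eq μ.2 h
    exact ⟨⟨P, hP⟩, ha, Subtype.ext hμ⟩

theorem continuous_srcPF : Continuous (srcPF (A := A)) := by
  refine continuous_generateFrom_iff.2 ?_
  rintro _ ⟨α, hα, rfl⟩
  refine isOpen_iff_forall_mem_open.2 fun P (hP : α ∈ A.dom '' P.1) => ?_
  obtain ⟨a, ha, rfl⟩ := hP
  exact ⟨A.basicOpen a, fun Q hQ => IsPrimeFilter.dom_mem hQ, A.isOpen_basicOpen a, ha⟩

theorem continuous_tgtPF : Continuous (tgtPF (A := A)) := by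
  refine continuous_generateFrom_iff.2 ?_
  rintro _ ⟨α, hα, rfl⟩
  refine isOpen_iff_forall_mem_open.2 fun P (hP : α ∈ tgtSet P.1) => ?_
  obtain ⟨-, a, ha, h⟩ := hP
  exact ⟨A.basicOpen a, fun Q hQ => ⟨hα, a, hQ, h⟩, A.isOpen_basicOpen a, ha⟩

theorem continuous_onePF : Continuous (onePF (A := A)) := by
  refine continuous_generateFrom_iff.2 ?_
  rintro _ ⟨a, rfl⟩
  refine isOpen_iff_forall_mem_open.2 fun μ (hμ : a ∈ oneSet μ.1) => ?_
  obtain ⟨α, hα, h⟩ := hμ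
  exact ⟨A.basicDom α, fun ν hν => ⟨α, hν, h⟩, isOpen_basicDom (μ.2.subset hα), hα⟩

theorem continuous_compPF :
    Continuous fun p : {p : A.PrimeFilters × A.PrimeFilters // tgtPF p.1 = srcPF p.2} =>
      compPF p.1.1 p.1.2 p.2 := by
  refine continuous_generateFrom_iff.2 ?_
  rintro _ ⟨c, rfl⟩
  refine isOpen_iff_forall_mem_open.2 fun p (hp : c ∈ compSet p.1.1.1 p.1.2.1) => ?_
  obtain ⟨a, ha, b, hb, h⟩ := hp
  refine ⟨Subtype.val ⁻¹' (A.basicOpen a ×ˢ A.basicOpen b), fun q hq => ⟨a, hq.1, b, hq.2, h⟩,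
    ((A.isOpen_basicOpen a).prod (A.isOpen_basicOpen b)).preimage continuous_subtype_val, ha, hb⟩

theorem isOpenMap_srcPF : IsOpenMap (srcPF (A := A)) := by
  refine A.isTopologicalBasis_basicOpen.isOpenMap_iff.2 ?_
  rintro _ ⟨a, rfl⟩
  rw [srcPF_image_basicOpen]
  exact isOpen_basicDom (dom_mem_domElts a)

theorem isOpenMap_tgtPF : IsOpenMap (tgtPF (A := A)) := by
  refine A.isTopologicalBasis_basicOpen.isOpenMap_iff.2 ?_
  rintro _ ⟨a, rfl⟩
  rw [tgtPF_image_basicOpen]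
  exact isOpen_basicDom (ran_mem_domElts a)

variable (A) in
/-- The Stone étale category of prime filters of `A`. -/
def primeFilterCategory : StoneEtaleCategory.{u} where
  Obj := A.DomUltrafilters
  Arr := A.PrimeFilters
  src := srcPF
  tgt := tgtPF
  one := onePF
  comp := compPF
  src_one μ := Subtype.ext (dom_image_oneSet μ.2)
  tgt_one μ := Subtype.ext (tgtSet_oneSet μ.2)
  src_comp P Q h := Subtype.ext (dom_image_compSet P.2 Q.2 (congrArg Subtype.val h))
  tgt_comp P Q h := Subtype.ext (tgtSet_compSet P.2 Q.2 (congrArg Subtype.val h))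
  one_comp P := Subtype.ext (oneSet_compSet P.2)
  comp_one P := Subtype.ext (compSet_oneSet P.2)
  assoc _ _ _ _ _ := Subtype.ext compSet_assoc
  continuous_src := continuous_srcPF
  continuous_tgt := continuous_tgtPF
  continuous_one := continuous_onePF
  continuous_comp := continuous_compPF
  isLocalHomeomorph_src := isLocalHomeomorph_of_continuous_isOpenMap_injOn continuous_srcPF
    isOpenMap_srcPF fun P => by
      obtain ⟨a, ha⟩ := P.2.nonempty
      exact ⟨A.basicOpen a, A.isOpen_basicOpen a, ha, injOn_srcPF a⟩
  isOpenMap_tgt := isOpenMap_tgtPF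
  compact_obj := inferInstance
  totallySeparated_obj := inferInstance
  epi P Q R h₁ h₂ h := Subtype.ext (compSet_cancel P.2 Q.2 R.2 (congrArg Subtype.val h₁)
    (congrArg Subtype.val h₂) (congrArg Subtype.val h))

end Category

/-! ### The multivalued functor induced by a homomorphism. -/

namespace Hom

variable {A B : FunctionAlgebra.{u}} (h : Hom A B)

theorem map_dom (a : A.carrier) : h.toFun (A.dom a) = B.dom (h.toFun a) := by
  rw [dom, h.map_anti, h.map_anti, dom]

theorem map_le {a b : A.carrier} (hab : A.le a b) : B.le (h.toFun a) (h.toFun b) := by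
  rw [le] at hab ⊢
  rw [← h.map_dom, ← h.map_comp, hab]

theorem map_domElts {α : A.carrier} (hα : α ∈ A.domElts) : h.toFun α ∈ B.domElts := by
  obtain ⟨a, rfl⟩ := hα
  exact ⟨h.toFun a, (h.map_anti a).symm⟩

theorem map_zero : h.toFun A.zero = B.zero := by
  rw [zero, h.map_comp, h.map_anti]
  refine eq_zero_of_forall fun x y hxy => ?_
  obtain ⟨h₁, h₂⟩ := (r_restrict (anti_mem_domElts _)).1 hxy
  exact (r_anti.1 h₁).2 _ h₂

theorem map_one : h.toFun A.one = B.one := by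
  rw [one, h.map_anti, h.map_zero, one]

/-- The inverse image of an ultrafilter under a homomorphism. -/
def pullback (μ : B.DomUltrafilters) : A.DomUltrafilters where
  val := {α | α ∈ A.domElts ∧ h.toFun α ∈ μ.1}
  property :=
    { subset := fun _ hα => hα.1
      nonempty := ⟨A.one, one_mem_domElts, h.map_one ▸ μ.2.one_mem⟩
      upward := fun α β hα hβ hαβ =>
        ⟨hβ, μ.2.upward _ _ hα.2 (h.map_domElts hβ) (h.map_le hαβ)⟩
      meet := fun α β hα hβ =>
        ⟨comp_mem_domElts hα.1 hβ.1, (h.map_comp α β).symm ▸ μ.2.meet _ _ hα.2 hβ.2⟩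
      ultra := fun α hα => by
        simp only [Set.mem_ofPred_eq, anti_mem_domElts, hα, true_and, h.map_anti]
        exact μ.2.ultra _ (h.map_domElts hα) }

variable {h} {P : B.PrimeFilters} {Q : A.PrimeFilters}

theorem srcPF_eq_of_subset (hPQ : Q.1 ⊆ h.toFun ⁻¹' P.1) : srcPF Q = h.pullback (srcPF P) := by
  refine Subtype.ext ((srcPF Q).2.eq_of_subset (h.pullback (srcPF P)).2 ?_)
  rintro _ ⟨a, ha, rfl⟩
  exact ⟨dom_mem_domElts a, _, hPQ ha, (h.map_dom a).symm⟩

theorem tgtPF_eq_of_subset (hPQ : Q.1 ⊆ h.toFun ⁻¹' P.1) : tgtPF Q = h.pullback (tgtPF P) := by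
  refine Subtype.ext ((tgtPF Q).2.eq_of_subset (h.pullback (tgtPF P)).2 ?_)
  rintro β ⟨hβ, a, ha, hle⟩
  exact ⟨hβ, h.map_domElts hβ, _, hPQ ha, h.map_ran a ▸ h.map_le hle⟩

/-- The inverse image of a prime filter need not be a filter base, but it is a union of prime
filters: take the germ of `a` at the pullback of the source. -/
theorem exists_subset_of_mem {a : A.carrier} (ha : h.toFun a ∈ P.1) :
    ∃ Q : A.PrimeFilters, a ∈ Q.1 ∧ Q.1 ⊆ h.toFun ⁻¹' P.1 := by
  have hd : A.dom a ∈ (h.pullback (srcPF P)).1 :=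
    ⟨dom_mem_domElts a, _, ha, (h.map_dom a).symm⟩
  refine ⟨germPF _ a hd, mem_germPF _ _ _, ?_⟩
  rintro b ⟨α, hα, hle⟩
  refine P.2.upward _ _ ?_ (h.map_le hle)
  rw [h.map_comp]
  exact P.2.restrict_mem hα.2 ha

theorem subset_of_mem {a : A.carrier} (ha : h.toFun a ∈ P.1) (haQ : a ∈ Q.1)
    (hs : srcPF Q = h.pullback (srcPF P)) : Q.1 ⊆ h.toFun ⁻¹' P.1 := by
  obtain ⟨Q', ha', hQ'⟩ := exists_subset_of_mem ha
  rwa [PrimeFilters.eq_of_mem (hs.trans (srcPF_eq_of_subset hQ').symm) haQ ha']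

variable (h)

theorem continuous_pullback : Continuous h.pullback := by
  refine continuous_generateFrom_iff.2 ?_
  rintro _ ⟨α, hα, rfl⟩
  convert isOpen_basicDom (h.map_domElts hα) using 1
  ext μ
  exact and_iff_right hα

/-- The star-coherent multivalued functor between categories of prime filters. -/
def primeFilterMap : StoneEtaleCategory.Hom (primeFilterCategory B) (primeFilterCategory A) where
  obj := h.pullback
  rel P Q := Q.1 ⊆ h.toFun ⁻¹' P.1
  src_rel _ _ := srcPF_eq_of_subset
  tgt_rel _ _ := tgtPF_eq_of_subset
  one_rel μ := by
    rintro a ⟨α, hα, hle⟩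
    exact ⟨_, hα.2, h.map_le hle⟩
  comp_rel := by
    rintro P₁ P₂ Q₁ Q₂ _ _ h₁ h₂ c ⟨a, ha, b, hb, hle⟩
    exact ⟨_, h₁ ha, _, h₂ hb, h.map_comp a b ▸ h.map_le hle⟩
  continuous_obj := h.continuous_pullback
  continuous_rel U hU := by
    refine isOpen_iff_forall_mem_open.2 ?_
    rintro P ⟨Q, hQ, hPQ⟩
    obtain ⟨a, ha, haU⟩ := exists_basicOpen_subset hU hQ
    refine ⟨B.basicOpen (h.toFun a), fun P' hP' => ?_, B.isOpen_basicOpen _, hPQ ha⟩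
    obtain ⟨Q', ha', hQ'⟩ := exists_subset_of_mem (h := h) hP'
    exact ⟨Q', haU ha', hQ'⟩
  starCoherent :=
    { star_injective := by
        intro P₁ P₂ Q hs h₁ h₂
        obtain ⟨a, ha⟩ := Q.2.nonempty
        exact PrimeFilters.eq_of_mem hs (h₁ ha) (h₂ ha)
      star_surjective := by
        intro μ Q hs
        obtain ⟨a, ha⟩ := Q.2.nonempty
        have hd : B.dom (h.toFun a) ∈ μ.1 := by
          have : A.dom a ∈ (h.pullback μ).1 := by
            rw [show h.pullback μ = srcPF Q from hs.symm]
            exact IsPrimeFilter.dom_mem ha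
          exact h.map_dom a ▸ this.2
        refine ⟨germPF μ _ hd, srcPF_germPF _ _ _, subset_of_mem (mem_germPF _ _ _) ha ?_⟩
        exact Eq.trans hs (congrArg h.pullback (srcPF_germPF μ _ hd).symm)
      coPseudoStar_surjective := by
        rintro ν U hU ⟨Q, hQ, ht⟩
        obtain ⟨a, ha, haU⟩ := exists_basicOpen_subset hU hQ
        have hr : A.ran a ∈ (h.pullback ν).1 := by
          rw [show h.pullback ν = tgtPF Q from ht.symm]
          exact ran_mem_tgtSet ha
        -- Preservation of range is what lifts the target condition: `R(h(a)) = h(R(a)) ∈ ν`, so `ν`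
        -- is the target of some prime filter containing `h(a)`.
        have hν : ν ∈ tgtPF '' B.basicOpen (h.toFun a) := by
          rw [tgtPF_image_basicOpen, ← h.map_ran]
          exact hr.2
        obtain ⟨P, hP, hPν⟩ := hν
        obtain ⟨Q', ha', hQ'⟩ := exists_subset_of_mem (h := h) hP
        exact ⟨Q', haU ha', P, hPν, hQ'⟩ }

end Hom

/-- The prime filter functor. -/
def primeFilterFunctor : FunctionAlgebra.{u}ᵒᵖ ⥤ StoneEtaleCategory.{u} where
  obj A := primeFilterCategory A.unop
  map h := Hom.primeFilterMap h.unop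
  map_id A := by
    apply StoneEtaleCategory.Hom.ext
    · funext μ
      exact Subtype.ext (Set.ext fun α => and_iff_right_of_imp fun hα => μ.2.subset hα)
    · funext P Q
      exact propext ⟨fun h => (PrimeFilters.eq_of_subset h).symm, fun h => by
        change P = Q at h
        exact h ▸ Set.Subset.rfl⟩
  map_comp {A B C} h k := by
    apply StoneEtaleCategory.Hom.ext
    · funext μ
      refine Subtype.ext (Set.ext fun α => ?_)
      exact and_congr_right fun hα => (and_iff_right (Hom.map_domElts k.unop hα)).symm
    · funext P R
      refine propext ⟨fun hPR => ?_, ?_⟩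
      -- The intermediate prime filter is chosen through the image of one member of `R`; agreement
      -- of sources then forces the inclusion for all of `R`.
      · obtain ⟨c, hc⟩ := R.2.nonempty
        obtain ⟨Q, hcQ, hQ⟩ := Hom.exists_subset_of_mem (h := h.unop)
          (a := Hom.toFun k.unop c) (P := P) (hPR hc)
        refine ⟨Q, hQ, Hom.subset_of_mem hcQ hc ?_⟩
        rw [Hom.srcPF_eq_of_subset hQ, Hom.srcPF_eq_of_subset hPR]
        refine Subtype.ext (Set.ext fun α => ?_)
        exact and_congr_right fun hα => (and_iff_right (Hom.map_domElts k.unop hα)).symm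
      · rintro ⟨Q, hPQ, hQR⟩ a ha
        exact hPQ (hQR ha)

/-- The prime filter category is its own model. -/
def primeFilterModel (A : FunctionAlgebra.{u}) :
    PrimeFilterModel A (primeFilterCategory A).toTopologicalCategory where
  objEquiv := Homeomorph.refl _
  arrEquiv := Homeomorph.refl _
  src_eq _ := rfl
  tgt_eq _ := rfl
  one_eq _ := rfl
  comp_eq _ _ _ := rfl

theorem isPrimeFilterFunctor_primeFilterFunctor :
    IsPrimeFilterFunctor primeFilterFunctor.{u} :=
  ⟨primeFilterModel, fun _ _ _ => ⟨fun _ => rfl, fun _ _ => Iff.rfl⟩⟩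

/-- If only one prime filter lies inside the inverse image, it is the whole inverse image, which is
a union of such filters. Conversely, a prime inverse image contains no other prime filter, by
incomparability. -/
theorem locallyProper_iff {A B : FunctionAlgebra.{u}} (h : A ⟶ B) :
    locallyProper h ↔ StoneEtaleCategory.singleValued (primeFilterFunctor.map h.op) := by
  constructor
  · exact fun hh P => ⟨⟨_, hh P.1 P.2⟩, Set.Subset.rfl, fun Q hQ => PrimeFilters.eq_of_subset hQ⟩
  · intro hh P hP
    obtain ⟨Q, hQ, huniq⟩ := hh ⟨P, hP⟩
    have : Hom.toFun h ⁻¹' P = Q.1 := Set.Subset.antisymm (fun a ha => by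
      obtain ⟨Q', ha', hQ'⟩ := Hom.exists_subset_of_mem (h := h) (P := ⟨P, hP⟩) ha
      exact huniq Q' hQ' ▸ ha') hQ
    exact this ▸ Q.2

end FunctionAlgebra

namespace StoneEtaleCategory

open TopologicalCategory

/-! ### Sections of a Stone étale category and their operations. -/

section Sections

variable {C : StoneEtaleCategory.{u}}

instance : CompactSpace C.Obj := C.compact_obj

instance : TotallySeparatedSpace C.Obj := C.totallySeparated_obj

/-- Open sets of arrows on which the source map is injective, with closed set of sources. -/
structure IsSection (U : Set C.Arr) : Prop where
  isOpen : IsOpen U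
  injOn : Set.InjOn C.src U
  isClosed_src : IsClosed (C.src '' U)

theorem one_comp' (x : C.Obj) (g : C.Arr) (h : C.tgt (C.one x) = C.src g) :
    C.comp (C.one x) g h = g := by
  obtain rfl : x = C.src g := (C.tgt_one x).symm.trans h
  exact C.one_comp g

theorem comp_one' (f : C.Arr) (y : C.Obj) (h : C.tgt f = C.src (C.one y)) :
    C.comp f (C.one y) h = f := by
  obtain rfl : C.tgt f = y := h.trans (C.src_one y)
  exact C.comp_one f

/-- A continuous right inverse of a local homeomorphism is itself a local homeomorphism. -/
theorem isOpenMap_one : IsOpenMap C.one := by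
  refine (IsLocalHomeomorph.of_comp (g := C.src) ?_ C.isLocalHomeomorph_src
    C.continuous_one).isOpenMap
  rw [show C.src ∘ C.one = id from funext C.src_one]
  exact (Homeomorph.refl _).isLocalHomeomorph

namespace IsSection

variable {U V : Set C.Arr}

theorem isClopen_src (hU : IsSection U) : IsClopen (C.src '' U) :=
  ⟨hU.isClosed_src, C.isLocalHomeomorph_src.isOpenMap _ hU.isOpen⟩

/-- The source map embeds `U` onto a closed subset of a compact space. -/
theorem isCompact (hU : IsSection U) : IsCompact U := by
  have he : Topology.IsOpenEmbedding (U.domRestrict C.src) :=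
    .of_continuous_injective_isOpenMap (C.continuous_src.comp continuous_subtype_val)
      (Set.injOn_iff_injective.1 hU.injOn)
      (C.isLocalHomeomorph_src.isOpenMap.domRestrict hU.isOpen)
  rw [isCompact_iff_isCompact_univ, he.isInducing.isCompact_iff, Set.image_univ,
    Set.range_domRestrict]
  exact hU.isClosed_src.isCompact

theorem isClopen_tgt (hU : IsSection U) : IsClopen (C.tgt '' U) :=
  ⟨(hU.isCompact.image C.continuous_tgt).isClosed, C.isOpenMap_tgt _ hU.isOpen⟩

theorem restrict (hU : IsSection U) {K : Set C.Obj} (hK : IsClopen K) :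
    IsSection (U ∩ C.src ⁻¹' K) where
  isOpen := hU.isOpen.inter (hK.isOpen.preimage C.continuous_src)
  injOn := hU.injOn.mono Set.inter_subset_left
  isClosed_src := by
    rw [Set.image_inter_preimage]
    exact hU.isClosed_src.inter hK.isClosed

end IsSection

theorem image_src_one (K : Set C.Obj) : C.src '' (C.one '' K) = K := by
  rw [Set.image_image]
  simp [C.src_one]

theorem isSection_one {K : Set C.Obj} (hK : IsClopen K) : IsSection (C.one '' K) where
  isOpen := isOpenMap_one _ hK.isOpen
  injOn := by
    rintro _ ⟨x, -, rfl⟩ _ ⟨y, -, rfl⟩ h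
    rw [C.src_one, C.src_one] at h
    rw [h]
  isClosed_src := by
    rw [image_src_one]
    exact hK.isClosed

theorem isSection_empty : IsSection (∅ : Set C.Arr) where
  isOpen := isOpen_empty
  injOn := Set.injOn_empty _
  isClosed_src := by simp

/-- Every arrow has a neighbourhood basis of sections. -/
theorem exists_isSection_subset {W : Set C.Arr} (hW : IsOpen W) {f : C.Arr} (hf : f ∈ W) :
    ∃ U, IsSection U ∧ f ∈ U ∧ U ⊆ W := by
  obtain ⟨e, hfe, he⟩ := C.isLocalHomeomorph_src f
  have ho : IsOpen (e.source ∩ W) := e.open_source.inter hW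
  obtain ⟨K, hK, hfK, hKW⟩ := compact_exists_isClopen_in_isOpen
    (C.isLocalHomeomorph_src.isOpenMap _ ho) ⟨f, ⟨hfe, hf⟩, rfl⟩
  refine ⟨e.source ∩ W ∩ C.src ⁻¹' K, ⟨ho.inter (hK.isOpen.preimage C.continuous_src), ?_, ?_⟩,
    ⟨⟨hfe, hf⟩, hfK⟩, fun g hg => hg.1.2⟩
  · rw [he]
    exact e.injOn.mono fun g hg => hg.1.1
  · rw [Set.image_inter_preimage, Set.inter_eq_right.2 hKW]
    exact hK.isClosed

/-- The set of composites. -/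
def compSet (U V : Set C.Arr) : Set C.Arr :=
  {w | ∃ u ∈ U, ∃ v ∈ V, ∃ h, C.comp u v h = w}

/-- The source of a composite is the source of its first factor. The first projection from
composable pairs is a pullback of the source map, hence a local homeomorphism, so composition is one
too. -/
theorem isOpenMap_comp : IsOpenMap fun p : {p : C.Arr × C.Arr // C.tgt p.1 = C.src p.2} =>
    C.comp p.1.1 p.1.2 p.2 := by
  have hc : Continuous fun p : {p : C.Arr × C.Arr // C.tgt p.1 = C.src p.2} => p.1.1 :=
    continuous_fst.comp continuous_subtype_val
  refine (IsLocalHomeomorph.of_comp (g := C.src) ?_ C.isLocalHomeomorph_src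
    C.continuous_comp).isOpenMap
  rw [show C.src ∘ (fun p : {p : C.Arr × C.Arr // C.tgt p.1 = C.src p.2} =>
    C.comp p.1.1 p.1.2 p.2) = C.src ∘ fun p => p.1.1 from funext fun p => C.src_comp _ _ p.2]
  refine C.isLocalHomeomorph_src.comp
    (isLocalHomeomorph_of_continuous_isOpenMap_injOn hc ?_ fun p => ?_)
  · intro O hO
    refine isOpen_iff_forall_mem_open.2 ?_
    rintro _ ⟨p, hp, rfl⟩
    obtain ⟨O', hO', rfl⟩ := isOpen_induced_iff.1 hO
    obtain ⟨W₁, W₂, h₁, h₂, hp₁, hp₂, hW⟩ := isOpen_prod_iff.1 hO' _ _ hp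
    refine ⟨W₁ ∩ C.tgt ⁻¹' (C.src '' W₂), ?_, h₁.inter
      ((C.isLocalHomeomorph_src.isOpenMap _ h₂).preimage C.continuous_tgt),
      ⟨hp₁, ⟨_, hp₂, p.2.symm⟩⟩⟩
    rintro f ⟨hf, g, hg, hfg⟩
    exact ⟨⟨(f, g), hfg.symm⟩, hW ⟨hf, hg⟩, rfl⟩
  · obtain ⟨V, hV, hpV, -⟩ := exists_isSection_subset isOpen_univ (Set.mem_univ p.1.2)
    refine ⟨(fun p => p.1.2) ⁻¹' V,
      hV.isOpen.preimage (continuous_snd.comp continuous_subtype_val), hpV, ?_⟩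
    rintro ⟨⟨f, g⟩, h⟩ hg ⟨⟨f', g'⟩, h'⟩ hg' (hff : f = f')
    subst hff
    have : g = g' := hV.injOn hg hg' (h.symm.trans h')
    subst this
    rfl

theorem IsSection.comp {U V : Set C.Arr} (hU : IsSection U) (hV : IsSection V) :
    IsSection (compSet U V) where
  isOpen := by
    convert isOpenMap_comp (C := C) (Subtype.val ⁻¹' (U ×ˢ V))
      ((hU.isOpen.prod hV.isOpen).preimage continuous_subtype_val) using 1
    ext w
    constructor
    · rintro ⟨u, hu, v, hv, h, rfl⟩
      exact ⟨⟨(u, v), h⟩, ⟨hu, hv⟩, rfl⟩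
    · rintro ⟨⟨⟨u, v⟩, h⟩, ⟨hu, hv⟩, rfl⟩
      exact ⟨u, hu, v, hv, h, rfl⟩
  injOn := by
    rintro _ ⟨u, hu, v, hv, h, rfl⟩ _ ⟨u', hu', v', hv', h', rfl⟩ heq
    rw [C.src_comp, C.src_comp] at heq
    obtain rfl := hU.injOn hu hu' heq
    obtain rfl := hV.injOn hv hv' (h.symm.trans h')
    rfl
  isClosed_src := by
    have : C.src '' compSet U V = C.src '' (U ∩ C.tgt ⁻¹' (C.src '' V)) := by
      ext x
      constructor
      · rintro ⟨_, ⟨u, hu, v, hv, h, rfl⟩, rfl⟩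
        exact ⟨u, ⟨hu, v, hv, h.symm⟩, (C.src_comp _ _ _).symm⟩
      · rintro ⟨u, ⟨hu, v, hv, h⟩, rfl⟩
        exact ⟨_, ⟨u, hu, v, hv, h.symm, rfl⟩, C.src_comp _ _ _⟩
    rw [this]
    exact ((hU.isCompact.inter_right (hV.isClosed_src.preimage C.continuous_tgt)).image
      C.continuous_src).isClosed

theorem IsSection.pref {U V : Set C.Arr} (hU : IsSection U) (hV : IsSection V) :
    IsSection (U ∪ V ∩ C.src ⁻¹' (C.src '' U)ᶜ) := by
  have hV' := hV.restrict hU.isClopen_src.compl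
  refine ⟨hU.isOpen.union hV'.isOpen, ?_, ?_⟩
  · rintro f (hf | ⟨hf, hf'⟩) g (hg | ⟨hg, hg'⟩) h
    · exact hU.injOn hf hg h
    · exact (hg' ⟨f, hf, h⟩).elim
    · exact (hf' ⟨g, hg, h.symm⟩).elim
    · exact hV.injOn hf hg h
  · rw [Set.image_union]
    exact hU.isClosed_src.union hV'.isClosed_src

end Sections

/-! ### Faithful representation of the algebra of sections by partial functions. -/

section Action

variable (C : StoneEtaleCategory.{u})

/-- Sets of arrows with a common source, which is recorded. -/
@[ext]
structure Point : Type u where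
  base : C.Obj
  arrows : Set C.Arr
  src_eq : ∀ g ∈ arrows, C.src g = base

variable {C}

/-- The action of an arrow on sets of arrows by inverse image under precomposition. -/
structure Acts (f : C.Arr) (p q : Point C) : Prop where
  src_eq : C.src f = p.base
  tgt_eq : C.tgt f = q.base
  mem_iff : ∀ g (h : C.tgt f = C.src g), g ∈ q.arrows ↔ C.comp f g h ∈ p.arrows

theorem Acts.eq {f : C.Arr} {p q q' : Point C} (h : Acts f p q) (h' : Acts f p q') : q = q' := by
  refine Point.ext (h.tgt_eq.symm.trans h'.tgt_eq) (Set.ext fun g => ?_)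
  constructor
  · intro hg
    have hs : C.tgt f = C.src g := h.tgt_eq.trans (q.src_eq g hg).symm
    exact (h'.mem_iff g hs).2 ((h.mem_iff g hs).1 hg)
  · intro hg
    have hs : C.tgt f = C.src g := h'.tgt_eq.trans (q'.src_eq g hg).symm
    exact (h.mem_iff g hs).2 ((h'.mem_iff g hs).1 hg)

theorem exists_acts_right {f : C.Arr} {p : Point C} (h : C.src f = p.base) : ∃ q, Acts f p q :=
  ⟨⟨C.tgt f, {g | ∃ h : C.tgt f = C.src g, C.comp f g h ∈ p.arrows}, fun _ hg => hg.1.symm⟩,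
    h, rfl, fun _ h => ⟨fun hg => hg.2, fun hg => ⟨h, hg⟩⟩⟩

/-- The preimage is the set of all `f ; g` with `g` in `q`; that `f` is an epimorphism ensures no
further `g` is picked up. -/
theorem exists_acts_left {f : C.Arr} {q : Point C} (h : C.tgt f = q.base) : ∃ p, Acts f p q := by
  refine ⟨⟨C.src f, {k | ∃ g ∈ q.arrows, ∃ h : C.tgt f = C.src g, C.comp f g h = k}, ?_⟩,
    rfl, h, fun g h => ⟨fun hg => ⟨g, hg, h, rfl⟩, ?_⟩⟩
  · rintro _ ⟨g, -, h, rfl⟩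
    exact C.src_comp _ _ _
  · rintro ⟨g', hg', h', heq⟩
    exact C.epi f g' g h' h heq ▸ hg'

theorem acts_one {x : C.Obj} {p q : Point C} : Acts (C.one x) p q ↔ p = q ∧ p.base = x := by
  have key : ∀ p : Point C, p.base = x → Acts (C.one x) p p := by
    rintro p rfl
    exact ⟨C.src_one _, C.tgt_one _, fun g h => by rw [one_comp']⟩
  constructor
  · intro h
    have hp : p.base = x := h.src_eq.symm.trans (C.src_one x)
    exact ⟨(key p hp).eq h, hp⟩
  · rintro ⟨rfl, h⟩
    exact key p h

theorem Acts.comp {f g : C.Arr} (hfg : C.tgt f = C.src g) {p q s : Point C} (hf : Acts f p q)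
    (hg : Acts g q s) : Acts (C.comp f g hfg) p s where
  src_eq := (C.src_comp _ _ _).trans hf.src_eq
  tgt_eq := (C.tgt_comp _ _ _).trans hg.tgt_eq
  mem_iff k h := by
    have h' : C.tgt g = C.src k := (C.tgt_comp _ _ _).symm.trans h
    rw [hg.mem_iff k h', hf.mem_iff _ (hfg.trans (C.src_comp _ _ _).symm), C.assoc]

theorem acts_comp {f g : C.Arr} (hfg : C.tgt f = C.src g) {p s : Point C} :
    Acts (C.comp f g hfg) p s ↔ ∃ q, Acts f p q ∧ Acts g q s := by
  constructor
  · intro h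
    obtain ⟨q, hq⟩ := exists_acts_right ((C.src_comp f g hfg).symm.trans h.src_eq)
    obtain ⟨s', hs⟩ := exists_acts_right (hfg.symm.trans hq.tgt_eq)
    exact ⟨q, hq, (hq.comp hfg hs).eq h ▸ hs⟩
  · rintro ⟨q, hf, hg⟩
    exact hf.comp hfg hg

/-- The partial function on points given by a set of arrows. -/
def actionRel (U : Set C.Arr) : Set (Point C × Point C) := {p | ∃ f ∈ U, Acts f p.1 p.2}

theorem actionRel_subset {U V : Set C.Arr} (h : actionRel U ⊆ actionRel V) : U ⊆ V := by
  intro f hf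
  -- The test point `{f}` detects `f`: its image contains the identity at the target of `f`, so any
  -- `g` with the same effect satisfies `g ; 1 ∈ {f}`.
  obtain ⟨q, hq⟩ := exists_acts_right (f := f) (p := ⟨C.src f, {f}, by rintro _ rfl; rfl⟩) rfl
  obtain ⟨g, hg, hgq⟩ := h (show (_, q) ∈ actionRel U from ⟨f, hf, hq⟩)
  have h₁ : C.one (C.tgt f) ∈ q.arrows :=
    (hq.mem_iff _ (C.src_one _).symm).2 (C.comp_one f)
  have ht : C.tgt g = C.src (C.one (C.tgt f)) :=
    hgq.tgt_eq.trans (hq.tgt_eq.symm.trans (C.src_one _).symm)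
  have h₂ := (hgq.mem_iff _ ht).1 h₁
  rw [comp_one'] at h₂
  exact (show g = f from h₂) ▸ hg

theorem exists_actionRel_iff {U : Set C.Arr} {p : Point C} :
    (∃ q, (p, q) ∈ actionRel U) ↔ p.base ∈ C.src '' U := by
  constructor
  · rintro ⟨q, f, hf, h⟩
    exact ⟨f, hf, h.src_eq⟩
  · rintro ⟨f, hf, h⟩
    obtain ⟨q, hq⟩ := exists_acts_right h
    exact ⟨q, f, hf, hq⟩

theorem actionRel_one {K : Set C.Obj} {p q : Point C} :
    (p, q) ∈ actionRel (C.one '' K) ↔ p = q ∧ p.base ∈ K := by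
  constructor
  · rintro ⟨_, ⟨x, hx, rfl⟩, h⟩
    obtain ⟨h₁, h₂⟩ := acts_one.1 h
    exact ⟨h₁, (show p.base = x from h₂) ▸ hx⟩
  · rintro ⟨rfl, h⟩
    exact ⟨_, ⟨_, h, rfl⟩, acts_one.2 ⟨rfl, rfl⟩⟩

variable (C) in
/-- The algebra of sections. -/
def sectionAlgebra : FunctionAlgebra.{u} where
  carrier := {U : Set C.Arr // IsSection U}
  nonempty := ⟨⟨∅, isSection_empty⟩⟩
  comp U V := ⟨compSet U.1 V.1, U.2.comp V.2⟩
  anti U := ⟨C.one '' (C.src '' U.1)ᶜ, isSection_one U.2.isClopen_src.compl⟩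
  ran U := ⟨C.one '' (C.tgt '' U.1), isSection_one U.2.isClopen_tgt⟩
  pref U V := ⟨U.1 ∪ V.1 ∩ C.src ⁻¹' (C.src '' U.1)ᶜ, U.2.pref V.2⟩
  representable := by
    refine ⟨Point C, fun U => actionRel U.1, fun U V h => ?_, ?_, ?_, ?_, ?_, ?_⟩
    · exact Subtype.ext (Set.Subset.antisymm (actionRel_subset h.subset)
        (actionRel_subset h.symm.subset))
    · rintro ⟨U, hU⟩ p q q' ⟨f, hf, h⟩ ⟨f', hf', h'⟩
      obtain rfl := hU.injOn hf hf' (h.src_eq.trans h'.src_eq.symm)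
      exact h.eq h'
    · rintro ⟨U, hU⟩ ⟨V, hV⟩
      ext ⟨p, q⟩
      constructor
      · rintro ⟨_, ⟨u, hu, v, hv, h, rfl⟩, hpq⟩
        obtain ⟨s, h₁, h₂⟩ := (acts_comp h).1 hpq
        exact ⟨s, ⟨u, hu, h₁⟩, ⟨v, hv, h₂⟩⟩
      · rintro ⟨s, ⟨u, hu, h₁⟩, ⟨v, hv, h₂⟩⟩
        exact ⟨_, ⟨u, hu, v, hv, h₁.tgt_eq.trans h₂.src_eq.symm, rfl⟩, h₁.comp _ h₂⟩
    · rintro ⟨U, hU⟩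
      ext ⟨p, q⟩
      exact actionRel_one.trans (and_congr_right fun _ => not_congr exists_actionRel_iff.symm)
    · rintro ⟨U, hU⟩
      ext ⟨p, q⟩
      refine actionRel_one.trans (and_congr_right fun _ => ?_)
      constructor
      · rintro ⟨f, hf, h⟩
        obtain ⟨s, hs⟩ := exists_acts_left h
        exact ⟨s, f, hf, hs⟩
      · rintro ⟨s, f, hf, hs⟩
        exact ⟨f, hf, hs.tgt_eq⟩
    · rintro ⟨U, hU⟩ ⟨V, hV⟩
      ext ⟨p, q⟩
      constructor
      · rintro ⟨f, hf | ⟨hf, hf'⟩, h⟩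
        · exact Or.inl ⟨f, hf, h⟩
        · refine Or.inr ⟨fun hex => hf' ?_, f, hf, h⟩
          have := exists_actionRel_iff.1 hex
          rwa [← h.src_eq] at this
      · rintro (⟨f, hf, h⟩ | ⟨hex, f, hf, h⟩)
        · exact ⟨f, Or.inl hf, h⟩
        · refine ⟨f, Or.inr ⟨hf, fun hf' => hex (exists_actionRel_iff.2 ?_)⟩, h⟩
          rwa [← h.src_eq]

end Action

/-! ### Inverse images of sections under star-coherent multivalued functors. -/

section Functor

variable {C D : StoneEtaleCategory.{u}} (F : Hom C D)

/-- The arrows related to some member of `V`. -/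
def relPreimage (V : Set D.Arr) : Set C.Arr := {f | ∃ g ∈ V, F.rel f g}

theorem image_src_relPreimage (V : Set D.Arr) :
    C.src '' relPreimage F V = F.obj ⁻¹' (D.src '' V) := by
  ext x
  constructor
  · rintro ⟨f, ⟨g, hg, h⟩, rfl⟩
    exact ⟨g, hg, F.src_rel _ _ h⟩
  · rintro ⟨g, hg, h⟩
    obtain ⟨f, hf, hfg⟩ := F.starCoherent.star_surjective x g h
    exact ⟨f, ⟨g, hg, hfg⟩, hf⟩

theorem eq_of_rel {V : Set D.Arr} (hV : Set.InjOn D.src V) {f f' : C.Arr} {g g' : D.Arr}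
    (hg : g ∈ V) (hg' : g' ∈ V) (h : F.rel f g) (h' : F.rel f' g') (hs : C.src f = C.src f') :
    f = f' := by
  have : g = g' := hV hg hg' (by rw [F.src_rel _ _ h, F.src_rel _ _ h', hs])
  subst this
  exact F.starCoherent.star_injective _ _ _ hs h h'

theorem isSection_relPreimage {V : Set D.Arr} (hV : IsSection V) :
    IsSection (relPreimage F V) where
  isOpen := F.continuous_rel V hV.isOpen
  injOn := by
    rintro f ⟨g, hg, h⟩ f' ⟨g', hg', h'⟩ hs
    exact eq_of_rel F hV.injOn hg hg' h h' hs
  isClosed_src := by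
    rw [image_src_relPreimage]
    exact hV.isClosed_src.preimage F.continuous_obj

theorem relPreimage_one (K : Set D.Obj) :
    relPreimage F (D.one '' K) = C.one '' (F.obj ⁻¹' K) := by
  ext f
  constructor
  · rintro ⟨_, ⟨y, hy, rfl⟩, h⟩
    have hfy : y = F.obj (C.src f) := (D.src_one y).symm.trans (F.src_rel _ _ h)
    subst hfy
    exact ⟨C.src f, hy,
      F.starCoherent.star_injective _ _ _ (C.src_one _) (F.one_rel _) h⟩
  · rintro ⟨x, hx, rfl⟩
    exact ⟨_, ⟨_, hx, rfl⟩, F.one_rel x⟩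

/-- A factorisation in `D` is lifted factor by factor by star surjectivity; star injectivity
identifies the composite of the lifts with the given arrow. -/
theorem relPreimage_comp {U V : Set D.Arr} :
    relPreimage F (compSet U V) = compSet (relPreimage F U) (relPreimage F V) := by
  ext f
  constructor
  · rintro ⟨_, ⟨u, hu, v, hv, h, rfl⟩, hf⟩
    obtain ⟨f₁, hf₁, h₁⟩ := F.starCoherent.star_surjective (C.src f) u
      ((D.src_comp u v h).symm.trans (F.src_rel _ _ hf))
    obtain ⟨f₂, hf₂, h₂⟩ := F.starCoherent.star_surjective (C.tgt f₁) v
      (h.symm.trans (F.tgt_rel _ _ h₁))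
    refine ⟨f₁, ⟨u, hu, h₁⟩, f₂, ⟨v, hv, h₂⟩, hf₂.symm, ?_⟩
    exact F.starCoherent.star_injective _ _ _ ((C.src_comp _ _ _).trans hf₁)
      (F.comp_rel _ _ _ _ _ _ h₁ h₂) hf
  · rintro ⟨f₁, ⟨u, hu, h₁⟩, f₂, ⟨v, hv, h₂⟩, h, rfl⟩
    have huv : D.tgt u = D.src v := by rw [F.tgt_rel _ _ h₁, F.src_rel _ _ h₂, h]
    exact ⟨_, ⟨u, hu, v, hv, huv, rfl⟩, F.comp_rel _ _ _ _ h huv h₁ h₂⟩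

/-- Only arrows into `F(y)` up to an open set can be lifted to arrows into `y`, which suffices
because `V` is open. -/
theorem image_tgt_relPreimage {V : Set D.Arr} (hV : IsOpen V) :
    C.tgt '' relPreimage F V = F.obj ⁻¹' (D.tgt '' V) := by
  ext y
  constructor
  · rintro ⟨f, ⟨g, hg, h⟩, rfl⟩
    exact ⟨g, hg, F.tgt_rel _ _ h⟩
  · rintro ⟨g, hg, h⟩
    obtain ⟨g', hg', f, hf, hfg⟩ := F.starCoherent.coPseudoStar_surjective y V hV ⟨g, hg, h⟩
    exact ⟨f, ⟨g', hg', hfg⟩, hf⟩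

theorem relPreimage_pref {U V : Set D.Arr} :
    relPreimage F (U ∪ V ∩ D.src ⁻¹' (D.src '' U)ᶜ) =
      relPreimage F U ∪ relPreimage F V ∩ C.src ⁻¹' (C.src '' relPreimage F U)ᶜ := by
  rw [image_src_relPreimage]
  ext f
  constructor
  · rintro ⟨g, hg | ⟨hg, hg'⟩, h⟩
    · exact Or.inl ⟨g, hg, h⟩
    · refine Or.inr ⟨⟨g, hg, h⟩, fun hf => hg' ?_⟩
      rw [F.src_rel _ _ h]
      exact hf
  · rintro (⟨g, hg, h⟩ | ⟨⟨g, hg, h⟩, hf⟩)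
    · exact ⟨g, Or.inl hg, h⟩
    · refine ⟨g, Or.inr ⟨hg, fun hg' => hf ?_⟩, h⟩
      change D.src g ∈ D.src '' U at hg'
      rw [F.src_rel _ _ h] at hg'
      exact hg'

/-- The homomorphism between algebras of sections. -/
def sectionMap : FunctionAlgebra.Hom (sectionAlgebra D) (sectionAlgebra C) where
  toFun V := ⟨relPreimage F V.1, isSection_relPreimage F V.2⟩
  map_comp _ _ := Subtype.ext (relPreimage_comp F)
  map_anti U := Subtype.ext <| by
    change relPreimage F (D.one '' _) = C.one '' (C.src '' relPreimage F U.1)ᶜ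
    rw [relPreimage_one, image_src_relPreimage, Set.preimage_compl]
  map_ran U := Subtype.ext <| by
    change relPreimage F (D.one '' _) = C.one '' (C.tgt '' relPreimage F U.1)
    rw [relPreimage_one, image_tgt_relPreimage F U.2.isOpen]
  map_pref _ _ := Subtype.ext (relPreimage_pref F)

/-- The functor sending a Stone étale category to its algebra of sections. -/
def sectionFunctor : StoneEtaleCategory.{u} ⥤ FunctionAlgebra.{u}ᵒᵖ where
  obj C := Opposite.op (sectionAlgebra C)
  map F := Quiver.Hom.op (V := FunctionAlgebra) (sectionMap F)
  map_id _ := congrArg Quiver.Hom.op <| FunctionAlgebra.Hom.ext <| funext fun _ =>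
    Subtype.ext <| Set.ext fun f =>
      ⟨fun ⟨_, hg, h⟩ => (show f = _ from h) ▸ hg, fun hf => ⟨f, hf, rfl⟩⟩
  map_comp _ _ := congrArg Quiver.Hom.op <| FunctionAlgebra.Hom.ext <| funext fun _ =>
    Subtype.ext <| Set.ext fun _ =>
      ⟨fun ⟨k, hk, g, h₁, h₂⟩ => ⟨g, ⟨k, hk, h₂⟩, h₁⟩,
        fun ⟨g, ⟨k, hk, h₂⟩, h₁⟩ => ⟨k, hk, g, h₁, h₂⟩⟩

end Functor

end StoneEtaleCategory

/-! ### An algebra is isomorphic to the sections of its prime filter category. -/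

namespace FunctionAlgebra

open StoneEtaleCategory

variable {A : FunctionAlgebra.{u}}

theorem isSection_basicOpen (a : A.carrier) :
    IsSection (C := primeFilterCategory A) (A.basicOpen a) where
  isOpen := A.isOpen_basicOpen a
  injOn := injOn_srcPF a
  isClosed_src := by
    change IsClosed (srcPF '' A.basicOpen a)
    rw [srcPF_image_basicOpen]
    exact (isClopen_basicDom (dom_mem_domElts a)).isClosed

theorem basicOpen_comp (a b : A.carrier) : A.basicOpen (A.comp a b) =
    StoneEtaleCategory.compSet (C := primeFilterCategory A) (A.basicOpen a) (A.basicOpen b) := by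
  ext P
  constructor
  · intro hP
    have hμ := (srcPF P).2
    have hab : A.dom (A.comp a b) ∈ (srcPF P).1 := IsPrimeFilter.dom_mem hP
    have ha : A.dom a ∈ (srcPF P).1 := hμ.mem_of_r hab (dom_mem_domElts a) fun x hx => by
      obtain ⟨-, z, hz⟩ := r_dom.1 hx
      obtain ⟨y, hy, -⟩ := r_comp.1 hz
      exact r_dom.2 ⟨rfl, y, hy⟩
    have hb : A.dom b ∈ (tgtPF (germPF _ a ha)).1 := by
      refine (mem_tgtSet (germPF _ a ha).2 (mem_germPF _ a ha) (dom_mem_domElts b)).2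
        ((mem_germ hμ).2 ⟨_, hab, fun x y hx hxy => ?_⟩)
      obtain ⟨-, z, hz⟩ := r_dom.1 hx
      obtain ⟨y', hy', hb⟩ := r_comp.1 hz
      obtain rfl := r_func hxy hy'
      exact r_comp.2 ⟨y, hxy, r_dom.2 ⟨rfl, z, hb⟩⟩
    have hs := (srcPF_germPF _ b hb).symm
    refine ⟨germPF _ a ha, mem_germPF _ a ha, germPF _ b hb, mem_germPF _ b hb, hs, ?_⟩
    refine PrimeFilters.eq_of_mem (a := A.comp a b) (Eq.trans ?_ (srcPF_germPF _ a ha))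
      (comp_mem_compSet (mem_germPF _ a ha) (mem_germPF _ b hb)) hP
    exact (primeFilterCategory A).src_comp _ _ hs
  · rintro ⟨P, hP, Q, hQ, h, rfl⟩
    exact comp_mem_compSet hP hQ

theorem basicOpen_domElt {α : A.carrier} (hα : α ∈ A.domElts) :
    A.basicOpen α = onePF '' A.basicDom α := by
  ext P
  constructor
  · intro hP
    have h : α ∈ (srcPF P).1 := ⟨α, hP, dom_eq_self hα⟩
    exact ⟨srcPF P, h, PrimeFilters.eq_of_mem ((primeFilterCategory A).src_one _)
      (subset_oneSet h) hP⟩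
  · rintro ⟨μ, hμ, rfl⟩
    exact subset_oneSet hμ

theorem basicDom_anti (a : A.carrier) : A.basicDom (A.anti a) = (A.basicDom (A.dom a))ᶜ := by
  ext μ
  have := μ.2.ultra _ (anti_mem_domElts a)
  exact not_iff_not.1 (this.symm.trans not_not.symm)

theorem basicOpen_pref (a b : A.carrier) : A.basicOpen (A.pref a b) =
    A.basicOpen a ∪ A.basicOpen b ∩ srcPF ⁻¹' (srcPF '' A.basicOpen a)ᶜ := by
  rw [srcPF_image_basicOpen]
  ext P
  have hanti : A.dom a ∉ (srcPF P).1 → A.anti (A.dom a) ∈ (srcPF P).1 :=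
    ((srcPF P).2.ultra _ (dom_mem_domElts a)).2
  constructor
  · intro hP
    by_cases h : A.dom a ∈ (srcPF P).1
    · refine Or.inl (P.2.mem_of_r (P.2.restrict_mem h hP) fun x y hxy => ?_)
      obtain ⟨h₁, h₂⟩ := (r_restrict (dom_mem_domElts _)).1 hxy
      obtain ⟨-, z, hz⟩ := r_dom.1 h₁
      rcases r_pref.1 h₂ with h₂ | h₂
      · exact h₂
      · exact (h₂.1 z hz).elim
    · refine Or.inr ⟨P.2.mem_of_r (P.2.restrict_mem (hanti h) hP) fun x y hxy => ?_, h⟩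
      obtain ⟨h₁, h₂⟩ := (r_restrict (anti_mem_domElts _)).1 hxy
      rcases r_pref.1 h₂ with h₂ | h₂
      · exact ((r_anti.1 h₁).2 x (r_dom.2 ⟨rfl, y, h₂⟩)).elim
      · exact h₂.2
  · rintro (hP | ⟨hP, h⟩)
    · exact P.2.mem_of_r hP fun x y hxy => r_pref.2 (Or.inl hxy)
    · refine P.2.mem_of_r (P.2.restrict_mem (hanti h) hP) fun x y hxy => ?_
      obtain ⟨h₁, h₂⟩ := (r_restrict (anti_mem_domElts _)).1 hxy
      exact r_pref.2 (Or.inr ⟨fun z hz => (r_anti.1 h₁).2 x (r_dom.2 ⟨rfl, z, hz⟩), h₂⟩)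

/-- If `a` maps `x` to `y`, its germ at the principal ultrafilter of `x` contains `b` only if `b`
also maps `x` to `y`. -/
theorem le_of_basicOpen_subset {a b : A.carrier} (h : A.basicOpen a ⊆ A.basicOpen b) :
    A.le a b := by
  refine le_iff.2 fun x y hxy => ?_
  have ha : A.dom a ∈ (A.trace (pure x)).1 := ⟨dom_mem_domElts a, r_dom.2 ⟨rfl, y, hxy⟩⟩
  have hb := h (show germPF _ a ha ∈ A.basicOpen a from mem_germPF _ a ha)
  obtain ⟨α, hα, H⟩ := (mem_germ (A.trace (pure x)).2).1 hb
  exact H x y hα.2 hxy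

/-- By compactness `U` is covered by finitely many basic open subsets of `U`, which preferential
union glues into one. -/
theorem exists_basicOpen_eq {U : Set A.PrimeFilters}
    (hU : IsSection (C := primeFilterCategory A) U) : ∃ a, A.basicOpen a = U := by
  suffices h : ∃ a, U ⊆ A.basicOpen a ∧ A.basicOpen a ⊆ U by
    obtain ⟨a, h₁, h₂⟩ := h
    exact ⟨a, h₂.antisymm h₁⟩
  refine IsCompact.induction_on (p := fun S => ∃ a, S ⊆ A.basicOpen a ∧ A.basicOpen a ⊆ U)
    hU.isCompact ⟨A.zero, Set.empty_subset _, fun P hP => (P.2.zero_notMem hP).elim⟩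
    (fun S T hST ⟨a, h₁, h₂⟩ => ⟨a, hST.trans h₁, h₂⟩) ?_ ?_
  · rintro S T ⟨a, ha, haU⟩ ⟨b, hb, hbU⟩
    refine ⟨A.pref a b, ?_, ?_⟩
    · rw [basicOpen_pref]
      refine Set.union_subset (ha.trans Set.subset_union_left) fun P hP => ?_
      -- Where both pieces are defined they agree, since both lie in `U` and the source map is
      -- injective there; giving `a` preference loses nothing.
      by_cases h : srcPF P ∈ srcPF '' A.basicOpen a
      · obtain ⟨Q, hQ, hs⟩ := h
        exact Or.inl (hU.injOn (haU hQ) (hbU (hb hP)) hs ▸ hQ)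
      · exact Or.inr ⟨hb hP, h⟩
    · rw [basicOpen_pref]
      exact Set.union_subset haU (Set.inter_subset_left.trans hbU)
  · intro P hP
    obtain ⟨a, ha, haU⟩ := exists_basicOpen_subset hU.isOpen hP
    exact ⟨A.basicOpen a, mem_nhdsWithin_of_mem_nhds ((A.isOpen_basicOpen a).mem_nhds ha),
      a, Set.Subset.rfl, haU⟩

variable (A) in
/-- The homomorphism from an algebra to the algebra of sections of its prime filter category. -/
def toSections : Hom A (sectionAlgebra (primeFilterCategory A)) where
  toFun a := ⟨A.basicOpen a, isSection_basicOpen a⟩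
  map_comp a b := Subtype.ext (basicOpen_comp a b)
  map_anti a := Subtype.ext <| by
    change _ = onePF '' (srcPF '' A.basicOpen a)ᶜ
    rw [srcPF_image_basicOpen, ← basicDom_anti, ← basicOpen_domElt (anti_mem_domElts a)]
  map_ran a := Subtype.ext <| by
    change _ = onePF '' (tgtPF '' A.basicOpen a)
    rw [tgtPF_image_basicOpen, ← basicOpen_domElt (ran_mem_domElts a)]
  map_pref a b := Subtype.ext (basicOpen_pref a b)

theorem bijective_toSections : Function.Bijective A.toSections.toFun := by
  constructor
  · intro a b h
    have h' : A.basicOpen a = A.basicOpen b := congrArg Subtype.val h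
    exact le_antisymm (le_of_basicOpen_subset h'.subset) (le_of_basicOpen_subset h'.symm.subset)
  · rintro ⟨U, hU⟩
    obtain ⟨a, rfl⟩ := exists_basicOpen_eq hU
    exact ⟨a, rfl⟩

/-- A bijective homomorphism is an isomorphism. -/
noncomputable def isoOfBijective {A B : FunctionAlgebra.{u}} (h : Hom A B)
    (hh : Function.Bijective h.toFun) : A ≅ B :=
  let e := Equiv.ofBijective h.toFun hh
  have he : ∀ a, h.toFun (e.symm a) = a := e.apply_symm_apply
  { hom := h
    inv :=
      { toFun := e.symm
        map_comp := fun a b => hh.1 (by rw [h.map_comp, he, he, he])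
        map_anti := fun a => hh.1 (by rw [h.map_anti, he, he])
        map_ran := fun a => hh.1 (by rw [h.map_ran, he, he])
        map_pref := fun a b => hh.1 (by rw [h.map_pref, he, he, he]) }
    hom_inv_id := Hom.ext (funext e.symm_apply_apply)
    inv_hom_id := Hom.ext (funext he) }

/-- Every algebra is naturally isomorphic to the algebra of sections of its prime filter
category. -/
noncomputable def primeFilterSectionIso :
    primeFilterFunctor.{u} ⋙ sectionFunctor ≅ 𝟭 FunctionAlgebra.{u}ᵒᵖ :=
  NatIso.ofComponents (fun A => (isoOfBijective A.unop.toSections bijective_toSections).op)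
    fun {A B} f => by
      apply Quiver.Hom.unop_inj
      refine Hom.ext (funext fun b => Subtype.ext (Set.ext fun P => ?_))
      constructor
      · rintro ⟨Q, hQ, h⟩
        exact h hQ
      · intro hP
        obtain ⟨Q, hQ, h⟩ := Hom.exists_subset_of_mem (h := f.unop) (P := P) hP
        exact ⟨Q, hQ, h⟩

end FunctionAlgebra

/-! ### A Stone étale category is isomorphic to the prime filters of its sections. -/

namespace StoneEtaleCategory

open FunctionAlgebra

section Isomorphism

variable {C D : StoneEtaleCategory.{u}}

/-- The star-coherent functor given by homeomorphisms compatible with the category structures. -/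
def homOfHomeomorph (eo : C.Obj ≃ₜ D.Obj) (ea : C.Arr ≃ₜ D.Arr)
    (hsrc : ∀ f, D.src (ea f) = eo (C.src f)) (htgt : ∀ f, D.tgt (ea f) = eo (C.tgt f))
    (hone : ∀ x, ea (C.one x) = D.one (eo x))
    (hcomp : ∀ f g h h', ea (C.comp f g h) = D.comp (ea f) (ea g) h') : C ⟶ D where
  obj := eo
  rel f g := ea f = g
  src_rel := by
    rintro f _ rfl
    exact hsrc f
  tgt_rel := by
    rintro f _ rfl
    exact htgt f
  one_rel := hone
  comp_rel := by
    rintro f₁ f₂ _ _ hf hg rfl rfl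
    exact hcomp _ _ _ _
  continuous_obj := eo.continuous
  continuous_rel U hU := by
    convert hU.preimage ea.continuous using 1
    ext f
    exact ⟨fun ⟨_, hg, h⟩ => show ea f ∈ U from Eq.symm h ▸ hg, fun hf => ⟨_, hf, rfl⟩⟩
  starCoherent :=
    { star_injective := by
        rintro f₁ f₂ _ - rfl h
        exact (ea.injective h).symm
      star_surjective := fun x g h => ⟨ea.symm g, eo.injective (by
        rw [← hsrc, ea.apply_symm_apply, h]), ea.apply_symm_apply g⟩
      coPseudoStar_surjective := by
        rintro y U - ⟨g, hg, h⟩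
        exact ⟨g, hg, ea.symm g, eo.injective (by rw [← htgt, ea.apply_symm_apply, h]),
          ea.apply_symm_apply g⟩ }

/-- Homeomorphisms compatible with the category structures give an isomorphism. -/
def isoOfHomeomorph (eo : C.Obj ≃ₜ D.Obj) (ea : C.Arr ≃ₜ D.Arr)
    (hsrc : ∀ f, D.src (ea f) = eo (C.src f)) (htgt : ∀ f, D.tgt (ea f) = eo (C.tgt f))
    (hone : ∀ x, ea (C.one x) = D.one (eo x))
    (hcomp : ∀ f g h h', ea (C.comp f g h) = D.comp (ea f) (ea g) h') : C ≅ D where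
  hom := homOfHomeomorph eo ea hsrc htgt hone hcomp
  inv := homOfHomeomorph eo.symm ea.symm
    (fun f => eo.injective (by rw [← hsrc, ea.apply_symm_apply, eo.apply_symm_apply]))
    (fun f => eo.injective (by rw [← htgt, ea.apply_symm_apply, eo.apply_symm_apply]))
    (fun x => ea.injective (by rw [hone, ea.apply_symm_apply, eo.apply_symm_apply]))
    (fun f g h h' => ea.injective (by
      rw [hcomp _ _ _ (by rw [ea.apply_symm_apply, ea.apply_symm_apply, h])]
      simp only [ea.apply_symm_apply]))
  hom_inv_id := by
    apply Hom.ext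
    · exact funext eo.symm_apply_apply
    · funext f g
      refine propext ⟨?_, ?_⟩
      · rintro ⟨_, rfl, h⟩
        exact (ea.symm_apply_apply f).symm.trans h
      · intro h
        exact ⟨_, rfl, (ea.symm_apply_apply f).trans h⟩
  inv_hom_id := by
    apply Hom.ext
    · exact funext eo.apply_symm_apply
    · funext f g
      refine propext ⟨?_, ?_⟩
      · rintro ⟨_, rfl, h⟩
        exact (ea.apply_symm_apply f).symm.trans h
      · intro h
        exact ⟨_, rfl, (ea.apply_symm_apply f).trans h⟩

/-- Some `g` is related to `f` by `e.hom` and back to `f` by `e.inv`. Any other value `g'` of `f` is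
then related to `g` by the identity. -/
theorem singleValued_iso_hom (e : C ≅ D) : singleValued e.hom := by
  have key : ∀ f f', (∃ g, (Hom.toMultivaluedFunctor e.hom).rel f g ∧
      (Hom.toMultivaluedFunctor e.inv).rel g f') ↔ f = f' := fun f f' =>
    iff_of_eq (congrArg (fun F : C ⟶ C => (Hom.toMultivaluedFunctor F).rel f f') e.hom_inv_id)
  have key' : ∀ g g', (∃ f, (Hom.toMultivaluedFunctor e.inv).rel g f ∧
      (Hom.toMultivaluedFunctor e.hom).rel f g') ↔ g = g' := fun g g' =>
    iff_of_eq (congrArg (fun F : D ⟶ D => (Hom.toMultivaluedFunctor F).rel g g') e.inv_hom_id)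
  intro f
  obtain ⟨g, h, h'⟩ := (key f f).2 rfl
  exact ⟨g, h, fun g' hg' => ((key' g g').1 ⟨f, h', hg'⟩).symm⟩

end Isomorphism

section Sections

variable {C : StoneEtaleCategory.{u}}

theorem compSet_one (K : Set C.Obj) (V : Set C.Arr) :
    compSet (C.one '' K) V = V ∩ C.src ⁻¹' K := by
  ext f
  constructor
  · rintro ⟨_, ⟨x, hx, rfl⟩, v, hv, h, rfl⟩
    rw [one_comp']
    exact ⟨hv, show C.src v ∈ K from (h.symm.trans (C.tgt_one x)).symm ▸ hx⟩
  · rintro ⟨hf, hK⟩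
    exact ⟨_, ⟨_, hK, rfl⟩, f, hf, C.tgt_one _, C.one_comp f⟩

theorem coe_dom (U : (sectionAlgebra C).carrier) :
    ((sectionAlgebra C).dom U).1 = C.one '' (C.src '' U.1) := by
  change C.one '' (C.src '' (C.one '' (C.src '' U.1)ᶜ))ᶜ = _
  rw [image_src_one, compl_compl]

theorem le_iff_subset {U V : (sectionAlgebra C).carrier} :
    (sectionAlgebra C).le U V ↔ U.1 ⊆ V.1 := by
  have : ((sectionAlgebra C).comp ((sectionAlgebra C).dom U) V).1 =
      V.1 ∩ C.src ⁻¹' (C.src '' U.1) := by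
    change compSet ((sectionAlgebra C).dom U).1 V.1 = _
    rw [coe_dom, compSet_one]
  refine (Subtype.ext_iff.trans (iff_of_eq (congrArg (· = U.1) this))).trans ?_
  constructor
  · exact fun h => h ▸ Set.inter_subset_left
  · refine fun h => Set.Subset.antisymm ?_ fun f hf => ⟨h hf, f, hf, rfl⟩
    rintro f ⟨hf, g, hg, hs⟩
    exact V.2.injOn (h hg) hf hs ▸ hg

/-- The prime filter of sections containing an arrow. -/
def filterAt (f : C.Arr) : (sectionAlgebra C).PrimeFilters where
  val := {U | f ∈ U.1}
  property :=
    { nonempty := by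
        obtain ⟨U, hU, hf, -⟩ := exists_isSection_subset isOpen_univ (Set.mem_univ f)
        exact ⟨⟨U, hU⟩, hf⟩
      upward := fun U V hU h => le_iff_subset.1 h hU
      directed := fun U V hU hV => by
        obtain ⟨W, hW, hf, h⟩ :=
          exists_isSection_subset (U.2.isOpen.inter V.2.isOpen) (Set.mem_inter hU hV)
        exact ⟨⟨W, hW⟩, hf, le_iff_subset.2 (h.trans Set.inter_subset_left),
          le_iff_subset.2 (h.trans Set.inter_subset_right)⟩
      proper := fun h => by
        have : (⟨∅, isSection_empty⟩ : (sectionAlgebra C).carrier) ∈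
            {U : (sectionAlgebra C).carrier | f ∈ U.1} := h ▸ Set.mem_univ _
        exact this
      prime := fun U V h => Or.imp_right (fun h => h.1) h }

/-- The ultrafilter of clopen sets containing an object. -/
def pointAt (x : C.Obj) : (sectionAlgebra C).DomUltrafilters := srcPF (filterAt (C.one x))

theorem mem_pointAt {x : C.Obj} {α : (sectionAlgebra C).carrier} :
    α ∈ (pointAt x).1 ↔ α ∈ (sectionAlgebra C).domElts ∧ C.one x ∈ α.1 := by
  constructor
  · rintro ⟨U, hU, rfl⟩
    refine ⟨dom_mem_domElts U, ?_⟩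
    rw [coe_dom]
    exact ⟨x, ⟨_, hU, C.src_one x⟩, rfl⟩
  · rintro ⟨hα, h⟩
    exact ⟨α, h, dom_eq_self hα⟩

theorem one_mem_iff {α : (sectionAlgebra C).carrier} (hα : α ∈ (sectionAlgebra C).domElts)
    {x : C.Obj} : C.one x ∈ α.1 ↔ x ∈ C.src '' α.1 := by
  constructor
  · exact fun h => ⟨_, h, C.src_one x⟩
  · intro h
    rw [← dom_eq_self hα, coe_dom]
    exact ⟨x, h, rfl⟩

theorem srcPF_filterAt (f : C.Arr) : srcPF (filterAt f) = pointAt (C.src f) := by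
  refine Subtype.ext ((srcPF _).2.eq_of_subset (pointAt _).2 ?_)
  rintro _ ⟨U, hU, rfl⟩
  refine mem_pointAt.2 ⟨dom_mem_domElts U, ?_⟩
  rw [coe_dom]
  exact ⟨_, ⟨f, hU, rfl⟩, rfl⟩

theorem tgtPF_filterAt (f : C.Arr) : tgtPF (filterAt f) = pointAt (C.tgt f) := by
  refine Subtype.ext ((tgtPF _).2.eq_of_subset (pointAt _).2 ?_)
  rintro α ⟨hα, U, hU, h⟩
  exact mem_pointAt.2 ⟨hα, le_iff_subset.1 h ⟨_, ⟨f, hU, rfl⟩, rfl⟩⟩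

theorem onePF_pointAt (x : C.Obj) : onePF (pointAt x) = filterAt (C.one x) := by
  refine PrimeFilters.eq_of_subset ?_
  rintro U ⟨α, hα, h⟩
  exact le_iff_subset.1 h (mem_pointAt.1 hα).2

theorem compPF_filterAt (f g : C.Arr) (h : C.tgt f = C.src g)
    (h' : tgtPF (filterAt f) = srcPF (filterAt g)) :
    compPF (filterAt f) (filterAt g) h' = filterAt (C.comp f g h) := by
  refine PrimeFilters.eq_of_subset ?_
  rintro W ⟨U, hU, V, hV, hle⟩
  exact le_iff_subset.1 hle ⟨f, hU, g, hV, h, rfl⟩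

theorem injective_pointAt : Function.Injective (pointAt (C := C)) := by
  intro x y h
  by_contra hne
  obtain ⟨K, hK, hx, hy⟩ := exists_isClopen_of_totally_separated hne
  let α : (sectionAlgebra C).carrier := ⟨C.one '' K, isSection_one hK⟩
  have hα : α ∈ (sectionAlgebra C).domElts :=
    ⟨⟨C.one '' Kᶜ, isSection_one hK.compl⟩, Subtype.ext <| by
      change C.one '' (C.src '' (C.one '' Kᶜ))ᶜ = C.one '' K
      rw [image_src_one, compl_compl]⟩
  have hxα : α ∈ (pointAt x).1 := mem_pointAt.2 ⟨hα, x, hx, rfl⟩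
  rw [h, mem_pointAt, one_mem_iff hα] at hxα
  exact hy ((image_src_one K).subset hxα.2)

theorem injective_filterAt : Function.Injective (filterAt (C := C)) := by
  intro f g h
  obtain ⟨U, hU⟩ := (filterAt f).2.nonempty
  have hU' : U ∈ (filterAt g).1 := h ▸ hU
  refine U.2.injOn hU hU' (injective_pointAt ?_)
  rw [← srcPF_filterAt, h, srcPF_filterAt]

/-- The source images of the members of `μ` are nonempty, closed and directed, so compactness gives
a common point. -/
theorem surjective_pointAt : Function.Surjective (pointAt (C := C)) := by
  intro μ
  have : Nonempty μ.1 := μ.2.nonempty.to_subtype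
  obtain ⟨x, hx⟩ := IsCompact.nonempty_iInter_of_directed_nonempty_isCompact_isClosed
    (fun α : μ.1 => C.src '' α.1.1) (fun α β => by
      refine ⟨⟨_, μ.2.meet _ _ α.2 β.2⟩, ?_, ?_⟩
      · refine Set.image_mono (le_iff_subset.1 (le_iff.2 fun x y h => ?_))
        exact ((r_corestrict (μ.2.subset β.2)).1 h).1
      · refine Set.image_mono (le_iff_subset.1 (le_iff.2 fun x y h => ?_))
        exact ((r_restrict (μ.2.subset α.2)).1 h).2)
    (fun α => by
      rw [Set.image_nonempty, Set.nonempty_iff_ne_empty]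
      intro h
      refine (μ.2.ultra α.1 (μ.2.subset α.2)).1 (μ.2.upward _ _ α.2 (anti_mem_domElts _)
        (le_iff_subset.2 ?_)) α.2
      rw [h]
      exact Set.empty_subset _)
    (fun α => α.1.2.isClosed_src.isCompact) (fun α => α.1.2.isClosed_src)
  refine ⟨x, Subtype.ext (μ.2.eq_of_subset (pointAt x).2 fun α hα => ?_).symm⟩
  have hα' := μ.2.subset hα
  exact mem_pointAt.2 ⟨hα', (one_mem_iff hα').2 (Set.mem_iInter.1 hx ⟨α, hα⟩)⟩

theorem surjective_filterAt : Function.Surjective (filterAt (C := C)) := by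
  intro P
  obtain ⟨x, hx⟩ := surjective_pointAt (srcPF P)
  obtain ⟨U, hU⟩ := P.2.nonempty
  have h : (sectionAlgebra C).dom U ∈ (pointAt x).1 := hx ▸ IsPrimeFilter.dom_mem hU
  rw [mem_pointAt, coe_dom] at h
  obtain ⟨-, _, ⟨f, hf, rfl⟩, hfx⟩ := h
  refine ⟨f, PrimeFilters.eq_of_mem (a := U) ?_ hf hU⟩
  rw [srcPF_filterAt, ← hx, ← C.src_one (C.src f), hfx, C.src_one]

theorem continuous_filterAt : Continuous (filterAt (C := C)) := by
  refine continuous_generateFrom_iff.2 ?_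
  rintro _ ⟨U, rfl⟩
  exact U.2.isOpen

theorem isOpenMap_filterAt : IsOpenMap (filterAt (C := C)) := by
  intro W hW
  refine isOpen_iff_forall_mem_open.2 ?_
  rintro _ ⟨f, hf, rfl⟩
  obtain ⟨U, hU, hfU, hUW⟩ := exists_isSection_subset hW hf
  refine ⟨(sectionAlgebra C).basicOpen ⟨U, hU⟩, fun P hP => ?_, isOpen_basicOpen _ _, hfU⟩
  obtain ⟨g, rfl⟩ := surjective_filterAt P
  exact ⟨g, hUW hP, rfl⟩

theorem continuous_pointAt : Continuous (pointAt (C := C)) :=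
  continuous_srcPF.comp (continuous_filterAt.comp C.continuous_one)

variable (C) in
/-- Arrows are homeomorphic to prime filters of sections. -/
noncomputable def arrHomeomorph : C.Arr ≃ₜ (sectionAlgebra C).PrimeFilters :=
  Equiv.toHomeomorphOfContinuousOpen
    (Equiv.ofBijective filterAt ⟨injective_filterAt, surjective_filterAt⟩) continuous_filterAt isOpenMap_filterAt

variable (C) in
/-- Objects are homeomorphic to ultrafilters of clopen sets. -/
noncomputable def objHomeomorph : C.Obj ≃ₜ (sectionAlgebra C).DomUltrafilters :=
  Continuous.homeoOfEquivCompactToT2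
    (f := Equiv.ofBijective pointAt ⟨injective_pointAt, surjective_pointAt⟩) continuous_pointAt

variable (C) in
/-- A Stone étale category is isomorphic to the prime filter category of its sections. -/
noncomputable def isoPrimeFilterCategory : C ≅ primeFilterCategory (sectionAlgebra C) :=
  isoOfHomeomorph (objHomeomorph C) (arrHomeomorph C) srcPF_filterAt tgtPF_filterAt
    (fun x => (onePF_pointAt x).symm) (fun f g h h' => (compPF_filterAt f g h h').symm)

theorem pullback_pointAt {D : StoneEtaleCategory.{u}} (F : C ⟶ D) (x : C.Obj) :
    FunctionAlgebra.Hom.pullback (sectionMap F) (pointAt x) =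
      pointAt ((Hom.toMultivaluedFunctor F).obj x) := by
  refine (Subtype.ext ((pointAt _).2.eq_of_subset
    (FunctionAlgebra.Hom.pullback (sectionMap F) (pointAt x)).2 fun α hα => ?_)).symm
  obtain ⟨hα, h⟩ := mem_pointAt.1 hα
  exact ⟨hα, mem_pointAt.2 ⟨FunctionAlgebra.Hom.map_domElts _ hα, _, h, F.one_rel x⟩⟩

/-- A section through `g` yields some `g'` in it related to `f`. The inclusion also fixes the source
of `g`, and injectivity of the source map on the section gives `g' = g`. -/
theorem filterAt_subset_iff {D : StoneEtaleCategory.{u}} (F : C ⟶ D) (f : C.Arr) (g : D.Arr) :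
    (filterAt g).1 ⊆ (sectionMap F).toFun ⁻¹' (filterAt f).1 ↔
      (Hom.toMultivaluedFunctor F).rel f g := by
  constructor
  · intro h
    have hs := FunctionAlgebra.Hom.srcPF_eq_of_subset h
    rw [srcPF_filterAt, srcPF_filterAt, pullback_pointAt] at hs
    obtain ⟨U, hU⟩ := (filterAt g).2.nonempty
    obtain ⟨g', hg', hF⟩ := h hU
    have : g' = g := U.2.injOn hg' hU ((F.src_rel _ _ hF).trans (injective_pointAt hs).symm)
    exact this ▸ hF
  · exact fun h U hU => ⟨g, hU, h⟩

/-- Every Stone étale category is naturally isomorphic to the prime filter category of its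
sections. -/
noncomputable def sectionPrimeFilterIso :
    𝟭 StoneEtaleCategory.{u} ≅ sectionFunctor ⋙ primeFilterFunctor :=
  NatIso.ofComponents isoPrimeFilterCategory fun {C D} F => by
    apply Hom.ext
    · exact funext fun x => (pullback_pointAt F x).symm
    · funext f Q
      refine propext ⟨?_, ?_⟩
      · rintro ⟨g, hF, rfl⟩
        exact ⟨_, rfl, (filterAt_subset_iff F f g).2 hF⟩
      · rintro ⟨_, rfl, h⟩
        obtain ⟨g, rfl⟩ := surjective_filterAt Q
        exact ⟨g, (filterAt_subset_iff F f g).1 h, rfl⟩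

end Sections

end StoneEtaleCategory

/-! ### The equivalence and its restriction. -/

section Duality

open FunctionAlgebra StoneEtaleCategory

/-- The duality between algebras of partial functions and Stone étale categories. -/
noncomputable def primeFilterEquivalence :
    FunctionAlgebra.{u}ᵒᵖ ≌ StoneEtaleCategory.{u} :=
  CategoryTheory.Equivalence.mk primeFilterFunctor sectionFunctor primeFilterSectionIso.symm
    sectionPrimeFilterIso.symm

theorem locallyProper_iso_hom {A B : FunctionAlgebra.{u}} (e : A ≅ B) : locallyProper e.hom :=
  (locallyProper_iff e.hom).2 (singleValued_iso_hom (primeFilterFunctor.mapIso e.op))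

/-- By naturality, the double dual of `F` is `F` conjugated by isomorphisms, and isomorphisms are
single-valued. -/
theorem locallyProper_sectionMap {C D : StoneEtaleCategory.{u}} {F : C ⟶ D}
    (hF : singleValued F) : locallyProper (sectionFunctor.map F).unop := by
  rw [locallyProper_iff]
  have h := sectionPrimeFilterIso.hom.naturality F
  have h' : primeFilterFunctor.map (sectionFunctor.map F) =
      sectionPrimeFilterIso.inv.app C ≫ F ≫ sectionPrimeFilterIso.hom.app D := by
    rw [Functor.id_map, Functor.comp_map] at h
    rw [h, Iso.inv_hom_id_app_assoc]
  change singleValued (primeFilterFunctor.map (sectionFunctor.map F))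
  rw [h']
  exact singleValued.comp_mem _ _ (singleValued_iso_hom (sectionPrimeFilterIso.app C).symm)
    (singleValued.comp_mem _ _ hF (singleValued_iso_hom (sectionPrimeFilterIso.app D)))

/-- The prime filter functor on locally proper homomorphisms. -/
def primeFilterFunctorRestrict : LocallyProperAlgebras.{u}ᵒᵖ ⥤ SingleValuedCategories.{u} where
  obj A := ⟨primeFilterFunctor.obj (Opposite.op A.unop.obj)⟩
  map h := ⟨primeFilterFunctor.map h.unop.hom.op, (locallyProper_iff _).1 h.unop.property⟩
  map_id A := WideSubcategory.hom_ext _ (primeFilterFunctor.map_id (Opposite.op A.unop.obj))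
  map_comp h k := WideSubcategory.hom_ext _
    (primeFilterFunctor.map_comp h.unop.hom.op k.unop.hom.op)

/-- The section functor on star-coherent functors. -/
def sectionFunctorRestrict : SingleValuedCategories.{u} ⥤ LocallyProperAlgebras.{u}ᵒᵖ where
  obj C := Opposite.op ⟨(sectionFunctor.obj C.obj).unop⟩
  map F := Quiver.Hom.op (V := LocallyProperAlgebras)
    ⟨(sectionFunctor.map F.hom).unop, locallyProper_sectionMap F.property⟩
  map_id C := Quiver.Hom.unop_inj <| WideSubcategory.hom_ext _ <|
    congrArg Quiver.Hom.unop (sectionFunctor.map_id C.obj)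
  map_comp F G := Quiver.Hom.unop_inj <| WideSubcategory.hom_ext _ <|
    congrArg Quiver.Hom.unop (sectionFunctor.map_comp F.hom G.hom)

/-- The duality restricted to locally proper homomorphisms and star-coherent functors. -/
noncomputable def primeFilterEquivalenceRestrict :
    LocallyProperAlgebras.{u}ᵒᵖ ≌ SingleValuedCategories.{u} :=
  CategoryTheory.Equivalence.mk primeFilterFunctorRestrict sectionFunctorRestrict
    (NatIso.ofComponents (fun A =>
        let e := (primeFilterSectionIso.symm.app (Opposite.op A.unop.obj)).unop
        (WideSubcategory.isoMk (P := locallyProper.{u})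
          (X := ((primeFilterFunctorRestrict ⋙ sectionFunctorRestrict).obj A).unop)
          (Y := A.unop) e (locallyProper_iso_hom e) (locallyProper_iso_hom e.symm)).op)
      fun f => Quiver.Hom.unop_inj <| WideSubcategory.hom_ext _ <|
        congrArg Quiver.Hom.unop (primeFilterSectionIso.symm.hom.naturality f.unop.hom.op))
    (NatIso.ofComponents (fun C =>
        let e := sectionPrimeFilterIso.symm.app C.obj
        WideSubcategory.isoMk (P := singleValued.{u})
          (X := (sectionFunctorRestrict ⋙ primeFilterFunctorRestrict).obj C)
          (Y := C) e (singleValued_iso_hom e) (singleValued_iso_hom e.symm))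
      fun F => WideSubcategory.hom_ext _ (sectionPrimeFilterIso.symm.hom.naturality F.hom))

end Duality

theorem mainTheorem2 :
    ∃ (E : FunctionAlgebra.{u}ᵒᵖ ≌ StoneEtaleCategory.{u})
      (E' : LocallyProperAlgebras.{u}ᵒᵖ ≌ SingleValuedCategories.{u}),
      IsPrimeFilterFunctor E.functor ∧
      (wideSubcategoryInclusion FunctionAlgebra.locallyProper.{u}).op ⋙ E.functor =
        E'.functor ⋙ wideSubcategoryInclusion StoneEtaleCategory.singleValued.{u} ∧
      wideSubcategoryInclusion StoneEtaleCategory.singleValued.{u} ⋙ E.inverse =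
        E'.inverse ⋙ (wideSubcategoryInclusion FunctionAlgebra.locallyProper.{u}).op :=
  -- Both compatibilities are definitional, as the restricted functors reuse the objects and
  -- underlying maps of the unrestricted ones.
  ⟨primeFilterEquivalence, primeFilterEquivalenceRestrict,
    FunctionAlgebra.isPrimeFilterFunctor_primeFilterFunctor, rfl, rfl⟩
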